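/- **Setting.** Let $X$ be a compact Hausdorff space, $\gamma_1,\dots,\gamma_N\colon X\to X$ continuous maps (repetitions allowed), and $\mathbb X, U\subseteq X$ subsets such that: (i) $\mathbb X$ is dense in $X$ and $\gamma_k(\mathbb X)\subseteq\mathbb X$, $\gamma_k^{-1}(\mathbb X)\subseteq\mathbb X$ for all $k$; (ii) $\gamma_1(\mathbb X),\dots,\gamma_N(\mathbb X)$ are pairwise disjoint; (iii) each $\gamma_k|_{\mathbb X}$ is injective; (iv) each $\gamma_k$ is a topological embedding; (v) $U$ is a dense open set, and $\gamma_1(U),\dots,\gamma_N(U)$ are pairwise disjoint open subsets of $X$ contained in $U$; (vi) $\mathbb X\subseteq U$; (vii) $\mathbb X$ is comeager in $X$. **Notation.** For a finite sequence $\mathbf k=(k_n,\dots,k_1)$ in $I=\{1,\dots,N\}$ put $\gamma_{\mathbf k}=\gamma_{k_n}\circ\cdots\circ\gamma_{k_1}$ (the identity if $n=0$) and $\boldsymbol\gamma_{\mathbf k}(x)=(\gamma_{\mathbf k}(x),\dots,\gamma_{k_2}\gamma_{k_1}(x),\gamma_{k_1}(x),x)$. The system $\gamma$ is *essentially free* if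 $\{x\in X:\gamma_{\mathbf k}(x)=\gamma_{\mathbf l}(x)\}$ is nowhere dense for all finite sequences $\mathbf k\ne\mathbf l$. Let $M_{\mathbb X}$ be the algebra of bounded operators on $\ell^2(\mathbb X)$, with standard basis $(e_x)_{x\in\mathbb X}$, and let $D_{\mathbb X}$ be the set of $\alpha\in M_{\mathbb X}$ with $\langle e_x,\alpha e_y\rangle=0$ for all $x\ne y$. For $m,n\ge0$ let $X_{m,n}$ be the compact space of all pairs $((x_m,\dots,x_0),(y_n,\dots,y_0))$ with $x_0=y_0$, $x_{i+1}\in\{\gamma_1(x_i),\dots,\gamma_N(x_i)\}$ and $y_{i+1}\in\{\gamma_1(y_i),\dots,\gamma_N(y_i)\}$ for all $i$. For $f\in C(X_{m,n})$ let $\rho_{m,n}(f)\in M_{\mathbb X}$ be determined by $$\rho_{m,n}(f)e_{\gamma_{\mathbf k}(x)}=\sum_{\mathbf j\in I^m}f(\boldsymbol\gamma_{\mathbf j}(x),\boldsymbol\gamma_{\mathbf k}(x))\,e_{\gamma_{\mathbf j}(x)}\quad(x\in\mathbb X,\ \mathbf k\in I^n),$$ and $\rho_{m,n}(f)e_y=0$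 if $y\in\mathbb X$ is not of the form $\gamma_{\mathbf k}(x)$ with $x\in\mathbb X$, $\mathbf k\in I^n$. Let $E_{m,n}$ be the range of $\rho_{m,n}$. For $k\in\mathbb Z$ let $B_k$ be the closed linear span of $\bigcup_{m-n=k}E_{m,n}$, and $D_k=B_k\cap D_{\mathbb X}$. Let $A=C(X)$, let $G=\bigcup_k\{(\gamma_k(y),y):y\in X\}$, and define $\rho_A(a)e_x=a(x)e_x$ for $a\in A$ and $\rho_E(f)e_y=\sum_{k=1}^N f(\gamma_k(y),y)e_{\gamma_k(y)}$ for $f\in C(G)$. With $\upsilon_n$ the shift $e_k\mapsto e_{n+k}$ on $\ell^2(\mathbb Z)$, put $\hat\rho_A(a)=\rho_A(a)\otimes\upsilon_0$ and $\hat\rho_E(f)=\rho_E(f)\otimes\upsilon_1$ on $\ell^2(\mathbb X)\otimes\ell^2(\mathbb Z)$, let $C^*(\hat\rho)$ be the C*-algebra generated by $\hat\rho_A(A)\cup\hat\rho_E(C(G))$, and let $\hat D=\bigoplus_{k\in\mathbb Z}D_k\otimes\upsilon_k$ (the closed linear span of the $D_k\otimes\upsilon_k$). A *masa* of a C*-algebra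 is a maximal commutative C*-subalgebra. **Theorem.** The following are equivalent: (1) $\gamma$ is essentially free; (2) $D_k=\{0\}$ for all $k\in\mathbb Z$ with $k\ne0$; (3) $\hat D=D_0\otimes\upsilon_0$. Moreover, $\hat D$ is a masa of $C^*(\hat\rho)$, and if $\gamma$ is not essentially free, then $\hat\rho_A(A)$ is properly contained in $\hat D$ and is not a masa of $C^*(\hat\rho)$. -/

import Mathlib

open scoped InnerProductSpace TensorProduct ENNReal

noncomputable section

namespace KW

/-! ### Square matrices indexed by a set -/

/-- The Hilbert space `ℓ²(Y)`, i.e. the Hilbert space direct sum of copies of `ℂ` indexed by `Y`. -/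
abbrev Hil (Y : Type*) : Type _ := lp (fun _ : Y => ℂ) 2

/-- The C*-algebra of `Y`-squared matrices: all bounded operators on `ℓ²(Y)`. -/
abbrev Mat (Y : Type*) : Type _ := Hil Y →L[ℂ] Hil Y

open Classical in
/-- The standard basis vector of `ℓ²(Y)` at `x`. -/
def basisVec {Y : Type*} (x : Y) : Hil Y := lp.single 2 x (1 : ℂ)

theorem orthonormal_basisVec (Y : Type*) : Orthonormal ℂ (basisVec : Y → Hil Y) := by
  classical
  rw [orthonormal_iff_ite]
  intro i j
  rw [basisVec, basisVec, lp.inner_single_left, lp.single_apply, Pi.single_apply]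
  by_cases h : i = j <;> simp [h]

theorem basisVec_apply {Y : Type*} (x y : Y) [Decidable (y = x)] :
    (basisVec x : Hil Y) y = if y = x then 1 else 0 := by
  classical
  rw [basisVec, lp.single_apply, Pi.single_apply]
  congr

theorem inner_basisVec_left {Y : Type*} (x : Y) (v : Hil Y) : ⟪basisVec x, v⟫_ℂ = v x := by
  classical
  rw [basisVec, lp.inner_single_left]
  simp

/-- The space of diagonal matrices: `α` is diagonal if a non-vanishing `(x, y)`-entry
`⟪e_x, α e_y⟫` forces `x = y`. -/
def diagMat (Y : Type*) : Submodule ℂ (Mat Y) where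
  carrier := {α | ∀ x y : Y, ⟪basisVec x, α (basisVec y)⟫_ℂ ≠ 0 → x = y}
  add_mem' := by
    intro a b ha hb x y hxy
    by_contra hne
    have h1 : ⟪basisVec x, a (basisVec y)⟫_ℂ = 0 := by
      by_contra h; exact hne (ha x y h)
    have h2 : ⟪basisVec x, b (basisVec y)⟫_ℂ = 0 := by
      by_contra h; exact hne (hb x y h)
    apply hxy
    rw [add_apply, inner_add_right, h1, h2, add_zero]
  zero_mem' := by
    intro x y hxy
    simp at hxy
  smul_mem' := by
    intro c a ha x y hxy
    apply ha x y
    intro h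
    apply hxy
    rw [smul_apply, inner_smul_right, h, mul_zero]

/-- The isometry `e_x ↦ e_{g x}` of `ℓ²(Y)` induced by an injective map `g : Y → Y`. -/
def pushIso {Y : Type*} (g : Y → Y) (hg : Function.Injective g) : Hil Y →ₗᵢ[ℂ] Hil Y :=
  ((orthonormal_basisVec Y).comp g hg).orthogonalFamily.linearIsometry

theorem pushIso_basisVec {Y : Type*} (g : Y → Y) (hg : Function.Injective g) (x : Y) :
    pushIso g hg (basisVec x) = basisVec (g x) := by
  classical
  have : basisVec x = lp.single 2 x (1 : ℂ) := by
    unfold basisVec; congr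
  rw [pushIso, this, OrthogonalFamily.linearIsometry_apply_single]
  simp

/-- The diagonal operator `e_x ↦ g x • e_x` of `ℓ²(Y)` given by a bounded function `g`. -/
def diagOp {Y : Type*} (g : Y → ℂ) {C : ℝ} (hC : 0 ≤ C) (hg : ∀ x, ‖g x‖ ≤ C) : Mat Y :=
  lp.mapCLM 2 (fun x => g x • ContinuousLinearMap.id ℂ ℂ) hC (fun x => by
    rw [norm_smul]; simpa using hg x)

theorem diagOp_apply {Y : Type*} (g : Y → ℂ) {C : ℝ} (hC : 0 ≤ C) (hg : ∀ x, ‖g x‖ ≤ C)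
    (v : Hil Y) (x : Y) : diagOp g hC hg v x = g x * v x := by
  simp [diagOp]

theorem diagOp_basisVec {Y : Type*} (g : Y → ℂ) {C : ℝ} (hC : 0 ≤ C) (hg : ∀ x, ‖g x‖ ≤ C)
    (x : Y) : diagOp g hC hg (basisVec x) = g x • basisVec x := by
  classical
  ext y
  rw [diagOp_apply, lp.coeFn_smul, Pi.smul_apply, smul_eq_mul]
  by_cases h : y = x
  · rw [h]
  · rw [basisVec_apply, if_neg h, mul_zero, mul_zero]

/-! ### Tensoring with the canonical unitaries of the group C*-algebra of `ℤ` -/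

/-- The bilateral shift `e_k ↦ e_{n + k}` on `ℓ²(ℤ)`. -/
def shift (n : ℤ) : Mat ℤ :=
  (pushIso (fun k : ℤ => n + k) (add_right_injective n)).toContinuousLinearMap

/-- The Hilbert space tensor product of two Hilbert spaces: the completion of their algebraic
tensor product for the inner product `⟪v ⊗ w, v' ⊗ w'⟫ = ⟪v, v'⟫ * ⟪w, w'⟫`. -/
def HTensor (H K : Type*) [NormedAddCommGroup H] [InnerProductSpace ℂ H]
    [NormedAddCommGroup K] [InnerProductSpace ℂ K] : Type _ :=
  UniformSpace.Completion (H ⊗[ℂ] K)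

namespace HTensor

variable {H K : Type*} [NormedAddCommGroup H] [InnerProductSpace ℂ H]
  [NormedAddCommGroup K] [InnerProductSpace ℂ K]

instance instNormedAddCommGroup : NormedAddCommGroup (HTensor H K) :=
  inferInstanceAs (NormedAddCommGroup (UniformSpace.Completion (H ⊗[ℂ] K)))

instance instInnerProductSpace : InnerProductSpace ℂ (HTensor H K) :=
  inferInstanceAs (InnerProductSpace ℂ (UniformSpace.Completion (H ⊗[ℂ] K)))

instance instCompleteSpace : CompleteSpace (HTensor H K) :=
  inferInstanceAs (CompleteSpace (UniformSpace.Completion (H ⊗[ℂ] K)))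

/-- The canonical inclusion of the algebraic tensor product. -/
def incl (z : H ⊗[ℂ] K) : HTensor H K := (z : UniformSpace.Completion (H ⊗[ℂ] K))

theorem denseRange_incl : DenseRange (incl : H ⊗[ℂ] K → HTensor H K) :=
  UniformSpace.Completion.denseRange_coe

theorem incl_add (z w : H ⊗[ℂ] K) : incl (z + w) = incl z + incl w :=
  UniformSpace.Completion.coe_add z w

theorem incl_smul (c : ℂ) (z : H ⊗[ℂ] K) : incl (c • z) = c • incl z :=
  UniformSpace.Completion.coe_smul c z

theorem inner_incl (z w : H ⊗[ℂ] K) : ⟪incl z, incl w⟫_ℂ = ⟪z, w⟫_ℂ :=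
  UniformSpace.Completion.inner_coe z w

/-- The operator `α ⊗ β` on the Hilbert space tensor product, determined by
`(α ⊗ β) (v ⊗ w) = α v ⊗ β w`. -/
def map (α : H →L[ℂ] H) (β : K →L[ℂ] K) : HTensor H K →L[ℂ] HTensor H K :=
  (TensorProduct.mapL α β).completion

theorem map_incl (α : H →L[ℂ] H) (β : K →L[ℂ] K) (z : H ⊗[ℂ] K) :
    map α β (incl z) = incl (TensorProduct.mapL α β z) :=
  ContinuousLinearMap.completion_apply_coe _ z

theorem map_tmul (α : H →L[ℂ] H) (β : K →L[ℂ] K) (v : H) (w : K) :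
    map α β (incl (v ⊗ₜ[ℂ] w)) = incl (α v ⊗ₜ[ℂ] β w) := map_incl α β _

theorem ext_incl {S T : HTensor H K →L[ℂ] HTensor H K} (h : ∀ z, S (incl z) = T (incl z)) :
    S = T :=
  ContinuousLinearMap.coeFn_injective
    (denseRange_incl.equalizer S.continuous T.continuous (funext h))

/-- The linear map `α ↦ α ⊗ β`. -/
def mapRight (β : K →L[ℂ] K) : (H →L[ℂ] H) →ₗ[ℂ] (HTensor H K →L[ℂ] HTensor H K) where
  toFun α := map α β
  map_add' a b := ext_incl fun z => by
    simp only [add_apply, map_incl, TensorProduct.mapL_add_left, incl_add]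
  map_smul' c a := ext_incl fun z => by
    simp only [smul_apply, map_incl, TensorProduct.mapL_smul_left, incl_smul, RingHom.id_apply]

end HTensor

/-- All bounded operators on the Hilbert space tensor product of `ℓ²(Y)` and `ℓ²(ℤ)`; the (spatial)
tensor product of `Mat Y` with the group C*-algebra of `ℤ` is a C*-subalgebra. -/
abbrev HatMat (Y : Type*) : Type _ := HTensor (Hil Y) (Hil ℤ) →L[ℂ] HTensor (Hil Y) (Hil ℤ)

/-- The linear map `α ↦ α ⊗ υ_n`, where `υ_n` is the shift by `n`. -/
def tensorShift (Y : Type*) (n : ℤ) : Mat Y →ₗ[ℂ] HatMat Y := HTensor.mapRight (shift n)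

/-! ### Iterated function systems, chains and bichains -/

section IFS

variable {X : Type*} [TopologicalSpace X] {N : ℕ}

/-- The points `x, γ_{k₁} x, γ_{k₂} γ_{k₁} x, …` obtained from an index sequence
`(k_n, …, k_1)`; here `k i` is the index `k_{i+1}`. -/
def path (γ : Fin N → C(X, X)) {n : ℕ} (k : Fin n → Fin N) (x : X) : Fin (n + 1) → X :=
  Fin.induction (motive := fun _ => X) x (fun i y => γ (k i) y)

@[simp] theorem path_zero (γ : Fin N → C(X, X)) {n : ℕ} (k : Fin n → Fin N) (x : X) :
    path γ k x 0 = x := rfl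

@[simp] theorem path_succ (γ : Fin N → C(X, X)) {n : ℕ} (k : Fin n → Fin N) (x : X) (i : Fin n) :
    path γ k x i.succ = γ (k i) (path γ k x i.castSucc) := by
  simp [path]

/-- The composition `γ_{k_n} ∘ ⋯ ∘ γ_{k_1}`; the identity for the empty sequence. -/
def comp (γ : Fin N → C(X, X)) {n : ℕ} (k : Fin n → Fin N) (x : X) : X :=
  path γ k x (Fin.last n)

/-- Essential freeness: the coincidence set of the compositions along any two distinct finite
index sequences (possibly of different lengths, possibly empty) is nowhere dense. -/
def EssentiallyFree (γ : Fin N → C(X, X)) : Prop :=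
  ∀ k l : (Σ n : ℕ, Fin n → Fin N), k ≠ l → IsNowhereDense {x : X | comp γ k.2 x = comp γ l.2 x}

/-- `(x_n, …, x_0)` is a chain if each `x_{i+1}` is the image of `x_i` under some `γ_k`. -/
def IsChain (γ : Fin N → C(X, X)) {n : ℕ} (x : Fin (n + 1) → X) : Prop :=
  ∀ i : Fin n, ∃ k : Fin N, x i.succ = γ k (x i.castSucc)

/-- The set of pairs of chains of lengths `m`, `n` with the same starting point `x_0 = y_0`. -/
def bichainSet (γ : Fin N → C(X, X)) (m n : ℕ) : Set ((Fin (m + 1) → X) × (Fin (n + 1) → X)) :=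
  {z | IsChain γ z.1 ∧ IsChain γ z.2 ∧ z.1 0 = z.2 0}

/-- The space of bichains of length `(m, n)`, with the subspace topology. -/
abbrev Bichain (γ : Fin N → C(X, X)) (m n : ℕ) : Type _ := bichainSet γ m n

/-- The graph of `γ`: all pairs `(γ_k y, y)`. -/
def graphSet (γ : Fin N → C(X, X)) : Set (X × X) := ⋃ k : Fin N, {z | z.1 = γ k z.2}

/-- The graph of `γ`, with the subspace topology. -/
abbrev Graph (γ : Fin N → C(X, X)) : Type _ := graphSet γ

theorem isClosed_setOf_isChain [T2Space X] (γ : Fin N → C(X, X)) (n : ℕ) :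
    IsClosed {x : Fin (n + 1) → X | IsChain γ x} := by
  have : {x : Fin (n + 1) → X | IsChain γ x} =
      ⋂ i : Fin n, ⋃ k : Fin N, {x : Fin (n + 1) → X | x i.succ = γ k (x i.castSucc)} := by
    ext x; simp [IsChain]
  rw [this]
  refine isClosed_iInter fun i => isClosed_iUnion_of_finite fun k => ?_
  exact isClosed_eq (continuous_apply _) ((γ k).continuous.comp (continuous_apply _))

instance instCompactSpaceBichain [CompactSpace X] [T2Space X] (γ : Fin N → C(X, X)) (m n : ℕ) :
    CompactSpace (Bichain γ m n) := by
  rw [← isCompact_iff_compactSpace]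
  apply IsClosed.isCompact
  refine ((isClosed_setOf_isChain γ m).preimage continuous_fst).inter
    (((isClosed_setOf_isChain γ n).preimage continuous_snd).inter ?_)
  exact isClosed_eq (by fun_prop) (by fun_prop)

instance instCompactSpaceGraph [CompactSpace X] [T2Space X] (γ : Fin N → C(X, X)) :
    CompactSpace (Graph γ) := by
  rw [← isCompact_iff_compactSpace]
  apply IsClosed.isCompact
  refine isClosed_iUnion_of_finite fun k => ?_
  exact isClosed_eq continuous_fst ((γ k).continuous.comp continuous_snd)

/-- The bichain of the chains starting at `x` along two index sequences. -/
def bichainAt (γ : Fin N → C(X, X)) {m n : ℕ} (j : Fin m → Fin N) (k : Fin n → Fin N) (x : X) :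
    Bichain γ m n :=
  ⟨(path γ j x, path γ k x), fun i => ⟨j i, path_succ γ j x i⟩, fun i => ⟨k i, path_succ γ k x i⟩,
    rfl⟩

/-- The point `(γ_k y, y)` of the graph. -/
def graphPt (γ : Fin N → C(X, X)) (k : Fin N) (y : X) : Graph γ :=
  ⟨(γ k y, y), Set.mem_iUnion.2 ⟨k, rfl⟩⟩

/-- The standing conditions on the subset `S` of `X`: it is dense and completely invariant
under `γ`, the images `γ_k(S)` are pairwise disjoint, and each `γ_k` is injective on `S`. -/
structure Admissible (γ : Fin N → C(X, X)) (S : Set X) : Prop where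
  dense : Dense S
  image_subset : ∀ k, γ k '' S ⊆ S
  preimage_subset : ∀ k, γ k ⁻¹' S ⊆ S
  disjoint : Pairwise fun j k => Disjoint (γ j '' S) (γ k '' S)
  injOn : ∀ k, Set.InjOn (γ k) S

namespace Admissible

variable {γ : Fin N → C(X, X)} {S : Set X}

theorem path_mem (h : Admissible γ S) {n : ℕ} (k : Fin n → Fin N) (x : S) (i : Fin (n + 1)) :
    path γ k x i ∈ S := by
  induction i using Fin.induction with
  | zero => exact x.2
  | succ i ih => rw [path_succ]; exact h.image_subset _ ⟨_, ih, rfl⟩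

theorem path_eq (h : Admissible γ S) {n : ℕ} (j k : Fin n → Fin N) (x y : S) (i : Fin (n + 1))
    (hxy : path γ j x i = path γ k y i) :
    x = y ∧ ∀ l : Fin n, l.castSucc < i → j l = k l := by
  induction i using Fin.induction with
  | zero => exact ⟨Subtype.ext hxy, fun l hl => absurd hl (Fin.not_lt_zero _)⟩
  | succ i ih =>
    rw [path_succ, path_succ] at hxy
    have hjk : j i = k i := by
      by_contra hne
      exact (h.disjoint hne).ne_of_mem ⟨_, h.path_mem j x _, rfl⟩ ⟨_, h.path_mem k y _, rfl⟩ hxy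
    rw [hjk] at hxy
    obtain ⟨h1, h2⟩ := ih (h.injOn _ (h.path_mem j x _) (h.path_mem k y _) hxy)
    refine ⟨h1, fun l hl => ?_⟩
    rcases (Fin.castSucc_lt_succ_iff.1 hl).lt_or_eq with hlt | rfl
    · exact h2 l (Fin.castSucc_lt_castSucc_iff.2 hlt)
    · exact hjk

/-- The restriction of `γ_{k_n} ∘ ⋯ ∘ γ_{k_1}` to a map from `S` to itself. -/
def compS (h : Admissible γ S) {n : ℕ} (k : Fin n → Fin N) (x : S) : S :=
  ⟨comp γ k x, h.path_mem k x _⟩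

theorem compS_eq (h : Admissible γ S) {n : ℕ} {j k : Fin n → Fin N} {x y : S}
    (hxy : h.compS j x = h.compS k y) : j = k ∧ x = y := by
  obtain ⟨h1, h2⟩ := h.path_eq j k x y (Fin.last n) (congrArg Subtype.val hxy)
  exact ⟨funext fun l => h2 l (Fin.castSucc_lt_last l), h1⟩

theorem compS_injective (h : Admissible γ S) {n : ℕ} (k : Fin n → Fin N) :
    Function.Injective (h.compS k) := fun _ _ hxy => (h.compS_eq hxy).2

/-- The restriction of `γ_k` to a map from `S` to itself. -/
def gamS (h : Admissible γ S) (k : Fin N) (x : S) : S := ⟨γ k x, h.image_subset k ⟨x, x.2, rfl⟩⟩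

theorem gamS_injective (h : Admissible γ S) (k : Fin N) : Function.Injective (h.gamS k) :=
  fun x y hxy => Subtype.ext (h.injOn k x.2 y.2 (congrArg Subtype.val hxy))

/-- The isometry `e_x ↦ e_{γ_k x}` of `ℓ²(S)` for an index sequence `k`. -/
def compOp (h : Admissible γ S) {n : ℕ} (k : Fin n → Fin N) : Mat S :=
  (pushIso (h.compS k) (h.compS_injective k)).toContinuousLinearMap

theorem adjoint_compOp_basisVec (h : Admissible γ S) {n : ℕ} (k : Fin n → Fin N) (y x : S) :
    (ContinuousLinearMap.adjoint (h.compOp k) (basisVec y) : Hil S) x =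
      ⟪basisVec (h.compS k x), basisVec y⟫_ℂ := by
  classical
  have h1 : ⟪(basisVec x : Hil S), ContinuousLinearMap.adjoint (h.compOp k) (basisVec y)⟫_ℂ =
      ⟪basisVec (h.compS k x), basisVec y⟫_ℂ := by
    rw [ContinuousLinearMap.adjoint_inner_right, compOp]
    simp [pushIso_basisVec]
  rw [← h1, inner_basisVec_left]

variable [CompactSpace X]

/-! ### The representations -/

/-- `ρ_A(a) e_x = a(x) e_x`. -/
def rhoA (_h : Admissible γ S) (a : C(X, ℂ)) : Mat S :=
  diagOp (fun x : S => a x) (norm_nonneg a) (fun x => a.norm_coe_le_norm x)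

theorem rhoA_basisVec (h : Admissible γ S) (a : C(X, ℂ)) (x : S) :
    h.rhoA a (basisVec x) = a x • basisVec x := diagOp_basisVec _ _ _ _

variable [T2Space X]

/-- `ρ_E(f) e_y = ∑_k f(γ_k y, y) e_{γ_k y}`, for `f` continuous on the graph. -/
def rhoE (h : Admissible γ S) (f : C(Graph γ, ℂ)) : Mat S :=
  ∑ k : Fin N, (pushIso (h.gamS k) (h.gamS_injective k)).toContinuousLinearMap ∘L
    diagOp (fun y : S => f (graphPt γ k y)) (norm_nonneg f) (fun _ => f.norm_coe_le_norm _)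

theorem rhoE_basisVec (h : Admissible γ S) (f : C(Graph γ, ℂ)) (y : S) :
    h.rhoE f (basisVec y) = ∑ k : Fin N, f (graphPt γ k y) • basisVec (h.gamS k y) := by
  simp [rhoE, diagOp_basisVec, pushIso_basisVec, sum_apply]

/-- The diagonal operator with entries `f` evaluated at the bichains along `(j, k)`. -/
def coeffOp (_h : Admissible γ S) {m n : ℕ} (f : C(Bichain γ m n, ℂ)) (j : Fin m → Fin N)
    (k : Fin n → Fin N) : Mat S :=
  diagOp (fun x : S => f (bichainAt γ j k x)) (norm_nonneg f) (fun _ => f.norm_coe_le_norm _)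

/-- The linear map `ρ_{m,n}` from continuous functions on the space of bichains to `Mat S`. It is
characterized by its values on the standard basis, which are computed in `rhoMN_basisVec` and
`rhoMN_basisVec_of_notMem`. -/
def rhoMN (h : Admissible γ S) (m n : ℕ) : C(Bichain γ m n, ℂ) →ₗ[ℂ] Mat S where
  toFun f := ∑ j : Fin m → Fin N, ∑ k : Fin n → Fin N,
    h.compOp j ∘L h.coeffOp f j k ∘L ContinuousLinearMap.adjoint (h.compOp k)
  map_add' f g := by
    simp only [← Finset.sum_add_distrib]
    refine Finset.sum_congr rfl fun j _ => Finset.sum_congr rfl fun k _ => ?_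
    rw [← ContinuousLinearMap.comp_add, ← ContinuousLinearMap.add_comp]
    congr 2
    ext v x
    simp [coeffOp, diagOp_apply, add_mul]
  map_smul' c f := by
    simp only [Finset.smul_sum, RingHom.id_apply]
    refine Finset.sum_congr rfl fun j _ => Finset.sum_congr rfl fun k _ => ?_
    rw [← ContinuousLinearMap.comp_smul, ← ContinuousLinearMap.smul_comp]
    congr 2
    ext v x
    simp [coeffOp, diagOp_apply, mul_assoc]

theorem rhoMN_apply (h : Admissible γ S) (m n : ℕ) (f : C(Bichain γ m n, ℂ)) :
    h.rhoMN m n f = ∑ j : Fin m → Fin N, ∑ k : Fin n → Fin N,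
      h.compOp j ∘L h.coeffOp f j k ∘L ContinuousLinearMap.adjoint (h.compOp k) := rfl

theorem rhoMN_basisVec (h : Admissible γ S) {m n : ℕ} (f : C(Bichain γ m n, ℂ))
    (k : Fin n → Fin N) (x : S) :
    h.rhoMN m n f (basisVec (h.compS k x)) =
      ∑ j : Fin m → Fin N, f (bichainAt γ j k x) • basisVec (h.compS j x) := by
  classical
  have hadj : ∀ k' : Fin n → Fin N,
      ContinuousLinearMap.adjoint (h.compOp k') (basisVec (h.compS k x)) =
        if k' = k then basisVec x else 0 := by
    intro k'
    ext z
    rw [adjoint_compOp_basisVec, orthonormal_iff_ite.1 (orthonormal_basisVec S)]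
    by_cases hk : k' = k
    · subst hk
      rw [if_pos rfl, basisVec_apply]
      simp only [(h.compS_injective k').eq_iff]
    · rw [if_neg hk, if_neg fun he => hk (h.compS_eq he).1]
      simp
  rw [rhoMN_apply, sum_apply]
  refine Finset.sum_congr rfl fun j _ => ?_
  rw [sum_apply, Finset.sum_eq_single k]
  · rw [ContinuousLinearMap.comp_apply, ContinuousLinearMap.comp_apply, hadj, if_pos rfl, coeffOp,
      diagOp_basisVec, map_smul, compOp, LinearIsometry.coe_toContinuousLinearMap, pushIso_basisVec]
  · intro k' _ hk
    simp [hadj, hk]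
  · simp

theorem rhoMN_basisVec_of_notMem (h : Admissible γ S) {m n : ℕ} (f : C(Bichain γ m n, ℂ))
    (y : S) (hy : ∀ (k : Fin n → Fin N) (x : S), h.compS k x ≠ y) :
    h.rhoMN m n f (basisVec y) = 0 := by
  classical
  have hadj : ∀ k : Fin n → Fin N, ContinuousLinearMap.adjoint (h.compOp k) (basisVec y) = 0 := by
    intro k
    ext z
    rw [adjoint_compOp_basisVec, orthonormal_iff_ite.1 (orthonormal_basisVec S), if_neg (hy k z)]
    simp
  simp [rhoMN_apply, sum_apply, hadj]

/-- The range `E_{m,n}` of `ρ_{m,n}`. -/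
def E (h : Admissible γ S) (m n : ℕ) : Submodule ℂ (Mat S) := LinearMap.range (h.rhoMN m n)

/-- `B_k`: the closed subspace of `Mat S` generated by all `E_{m,n}` with `m - n = k`. -/
def B (h : Admissible γ S) (k : ℤ) : Submodule ℂ (Mat S) :=
  (⨆ (m : ℕ) (n : ℕ) (_ : (m : ℤ) - (n : ℤ) = k), h.E m n).topologicalClosure

/-- `D_k`: the diagonal matrices in `B_k`. -/
def D (h : Admissible γ S) (k : ℤ) : Submodule ℂ (Mat S) := h.B k ⊓ diagMat S

/-- `ρ̂_A(a) = ρ_A(a) ⊗ υ_0`. -/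
def rhoHatA (h : Admissible γ S) (a : C(X, ℂ)) : HatMat S := tensorShift S 0 (h.rhoA a)

/-- `ρ̂_E(f) = ρ_E(f) ⊗ υ_1`. -/
def rhoHatE (h : Admissible γ S) (f : C(Graph γ, ℂ)) : HatMat S := tensorShift S 1 (h.rhoE f)

/-- The C*-algebra generated by the ranges of `ρ̂_A` and `ρ̂_E`. -/
def cstarHat (h : Admissible γ S) : NonUnitalStarSubalgebra ℂ (HatMat S) :=
  (NonUnitalStarAlgebra.adjoin ℂ
    (Set.range h.rhoHatA ∪ Set.range h.rhoHatE)).topologicalClosure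

/-- `D̂`: the closed direct sum of the subspaces `D_k ⊗ υ_k`. -/
def DHat (h : Admissible γ S) : Submodule ℂ (HatMat S) :=
  (⨆ k : ℤ, (h.D k).map (tensorShift S k)).topologicalClosure

end Admissible
end IFS

/-- `T` is a masa of the C*-subalgebra `C` of `A`: it is the underlying set of a commutative
C*-subalgebra of `C` that is maximal among all commutative C*-subalgebras of `C`. -/
def IsMasa {A : Type*} [NonUnitalSemiring A] [StarRing A] [Module ℂ A] [TopologicalSpace A]
    (C : NonUnitalStarSubalgebra ℂ A) (T : Set A) : Prop :=
  ∃ F : NonUnitalStarSubalgebra ℂ A, (F : Set A) = T ∧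
    Maximal (fun F' : NonUnitalStarSubalgebra ℂ A =>
      F' ≤ C ∧ IsClosed (F' : Set A) ∧ ∀ a ∈ F', ∀ b ∈ F', a * b = b * a) F

end KW

end

noncomputable section

namespace KW

/-! ### Closed submodules and Fourier coefficients -/

/-! The argument rests on a `ℤ`-grading. Conjugation by `1 ⊗ phase t` multiplies `α ⊗ υ_k` by the
character `fourier k t`, and the compression `coeff` extracts the component of degree `k`. An edge
`ρ_E(f)` lengthens the left chain of a bichain, while `ρ_E(f)* ρ_E(g)` lies in `ρ_A(A)`, so left
multiplication by generators and their adjoints respects the spaces `B_k`. Hence `C*(ρ̂)` is the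
closed span of the `B_k ⊗ υ_k` (`cstarHat_le_BHat`, `tensorShift_B_mem`).

Since `C(X)` separates points, a matrix is diagonal exactly when it commutes with `ρ_A(A)`. Taking
coefficients preserves this commutation, and an element is recovered from its coefficients by a
Fourier argument (`mem_of_tensorShift_coeff_mem`). So `D̂` is the relative commutant of `ρ̂_A(A)` in
`C*(ρ̂)` (`mem_DHat_iff`). It is commutative and contains `ρ̂_A(A)`, hence is a masa.

If the system is essentially free and `b` in `D_k`, `k ≠ 0`, has a nonzero entry at `x`, then `x =
γ_j z = γ_p z` for words whose lengths differ by `k`. The entry of `b` at `(γ_j w, γ_p w)` is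
continuous in `w` (`continuous_inner_of_mem_B`), so it is nonzero near `z`. Diagonality then makes
`γ_j` and `γ_p` agree on a dense part of an open set, which is impossible. Conversely, if `γ_j` and
`γ_k` agree on a nonempty open set, a bump function supported there, lifted to one branch of the
bichain space, gives a nonzero diagonal element of nonzero degree
(`exists_D_ne_bot_of_not_essentiallyFree`). Such an element lies outside `ρ̂_A(A)`, which lives in
degree `0`. -/

/-- A point outside a closed complex subspace is separated from it by a functional. -/
theorem exists_functional_of_notMem {E : Type*} [NormedAddCommGroup E] [NormedSpace ℂ E]
    (V : Submodule ℂ E) (hV : IsClosed (V : Set E)) {b : E} (hb : b ∉ V) :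
    ∃ φ : E →L[ℂ] ℂ, (∀ v ∈ V, φ v = 0) ∧ φ b ≠ 0 := by
  obtain ⟨f, u, hu, hfb⟩ := RCLike.geometric_hahn_banach_closed_point (𝕜 := ℂ)
    (s := (V : Set E)) (V.restrictScalars ℝ).convex hV hb
  have h0 : 0 < u := by simpa using hu 0 V.zero_mem
  have key : ∀ v ∈ V, f v = 0 := by
    intro v hv
    by_contra hne
    -- The rescaled vector stays in `V` but has `f`-value exactly `u`, against the strict bound.
    have := hu (((u : ℂ) / f v) • v) (V.smul_mem _ hv)
    rw [map_smul, smul_eq_mul, div_mul_cancel₀ _ hne] at this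
    simp at this
  refine ⟨f, key, fun h => ?_⟩
  rw [h] at hfb
  simp at hfb
  linarith

open AddCircle in
theorem fourierCoeff_fourier_eq (n k : ℤ) :
    fourierCoeff (fun t : AddCircle (1 : ℝ) => fourier n t) k = if n = k then 1 else 0 := by
  have : Fact (0 < (1 : ℝ)) := ⟨one_pos⟩
  have h := orthonormal_iff_ite.1 (orthonormal_fourier (T := 1)) k n
  have e : ∀ f : C(AddCircle (1 : ℝ), ℂ), fourierCoeff f k =
      ∫ t, (starRingEnd ℂ) (fourier k t) * f t ∂haarAddCircle := by
    intro f
    simp only [fourierCoeff, smul_eq_mul, fourier_neg]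
  rw [show (fun t : AddCircle (1 : ℝ) => fourier n t) = (fourier n : C(AddCircle (1 : ℝ), ℂ)) from rfl,
    e]
  rw [MeasureTheory.ContinuousMap.inner_toLp] at h
  simp only [eq_comm (a := n)]
  rw [← h]
  congr 1
  ext t
  ring

open AddCircle MeasureTheory in
/-- A vector in the closed span of the homogeneous spaces of a bounded action of the circle belongs
to every closed subspace that contains all its homogeneous components. -/
theorem mem_of_components_mem {E : Type*} [NormedAddCommGroup E] [NormedSpace ℂ E]
    (α : AddCircle (1 : ℝ) → E →L[ℂ] E) (hα : ∀ t b, ‖α t b‖ ≤ ‖b‖) (hα0 : ∀ b, α 0 b = b)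
    (P : ℤ → E →L[ℂ] E) (V : ℤ → Submodule ℂ E)
    (hαV : ∀ t k, ∀ v ∈ V k, α t v = fourier k t • v)
    (hPV : ∀ j k, ∀ v ∈ V k, P j v = if k = j then v else 0)
    (D : Submodule ℂ E) (hD : IsClosed (D : Set E)) {b : E}
    (hb : b ∈ (⨆ k, V k).topologicalClosure) (hPb : ∀ k, P k b ∈ D) : b ∈ D := by
  have : Fact (0 < (1 : ℝ)) := ⟨one_pos⟩
  by_contra hbD
  obtain ⟨φ, hφD, hφb⟩ := exists_functional_of_notMem D hD hbD
  -- On the algebraic sum the orbit function is a trigonometric polynomial, and its coefficients are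
  -- given by the `P j`.
  have halg : ∀ v ∈ (⨆ k, V k), Continuous (fun t => φ (α t v)) ∧
      ∀ j, fourierCoeff (fun t => φ (α t v)) j = φ (P j v) := by
    intro v hv
    induction hv using Submodule.iSup_induction' with
    | mem k v hv =>
      have e : (fun t => φ (α t v)) = φ v • (fun t : AddCircle (1 : ℝ) => (fourier k t : ℂ)) := by
        ext t
        rw [hαV t k v hv, map_smul, Pi.smul_apply, smul_eq_mul, smul_eq_mul, mul_comm]
      rw [e]
      refine ⟨(fourier k).continuous.const_smul _, fun j => ?_⟩
      rw [fourierCoeff.const_smul, fourierCoeff_fourier_eq, hPV j k v hv]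
      split_ifs <;> simp
    | zero => simp [fourierCoeff, continuous_const]
    | add v w _ _ h1 h2 =>
      have e : (fun t => φ (α t (v + w))) = (fun t => φ (α t v)) + fun t => φ (α t w) := by
        ext t; simp
      rw [e]
      refine ⟨h1.1.add h2.1, fun j => ?_⟩
      rw [fourierCoeff.add (h1.1.integrable_of_hasCompactSupport (HasCompactSupport.of_compactSpace _))
        (h2.1.integrable_of_hasCompactSupport (HasCompactSupport.of_compactSpace _)), Pi.add_apply,
        h1.2, h2.2, map_add, map_add]
  have hclose : ∀ ε > 0, ∃ v ∈ (⨆ k, V k), ‖b - v‖ < ε := by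
    intro ε hε
    obtain ⟨v, hv, hd⟩ := Metric.mem_closure_iff.1 hb ε hε
    exact ⟨v, hv, by rwa [← dist_eq_norm]⟩
  have hdiff : ∀ v t, ‖φ (α t b) - φ (α t v)‖ ≤ ‖φ‖ * ‖b - v‖ := by
    intro v t
    rw [← map_sub, ← map_sub]
    exact (φ.le_opNorm _).trans (mul_le_mul_of_nonneg_left (hα _ _) (norm_nonneg _))
  have hsmall : ∀ C : ℝ, 0 ≤ C → ∀ ε > 0, ∃ v ∈ (⨆ k, V k), C * ‖b - v‖ < ε := by
    intro C hC ε hε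
    obtain ⟨v, hv, h⟩ := hclose (ε / (C + 1)) (by positivity)
    refine ⟨v, hv, ?_⟩
    rw [lt_div_iff₀ (by positivity)] at h
    nlinarith [norm_nonneg (b - v)]
  -- No continuity of `α` in `t` is assumed: the contraction bound makes the orbit function of `b` a
  -- uniform limit of trigonometric polynomials.
  have hcont : Continuous (fun t => φ (α t b)) := by
    refine continuous_of_uniform_approx_of_continuous fun u hu => ?_
    obtain ⟨ε, hε, hu⟩ := Metric.mem_uniformity_dist.1 hu
    obtain ⟨v, hv, h⟩ := hsmall ‖φ‖ (norm_nonneg _) ε hε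
    refine ⟨_, (halg v hv).1, fun t => hu ?_⟩
    rw [dist_eq_norm]
    exact (hdiff v t).trans_lt h
  have hcoef : ∀ j, fourierCoeff (fun t => φ (α t b)) j = 0 := by
    intro j
    have e : fourierCoeff (fun t => φ (α t b)) j = φ (P j b) := by
      refine eq_of_forall_dist_le fun ε hε => ?_
      obtain ⟨v, hv, h⟩ := hsmall (‖φ‖ + ‖φ ∘L P j‖) (by positivity) ε hε
      have hint : ∀ g : AddCircle (1 : ℝ) → ℂ, Continuous g →
          Integrable (fun t => fourier (-j) t • g t) haarAddCircle := fun g hg =>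
        ((fourier (-j)).continuous.smul hg).integrable_of_hasCompactSupport
          (HasCompactSupport.of_compactSpace _)
      have h1 : ‖fourierCoeff (fun t => φ (α t b)) j - fourierCoeff (fun t => φ (α t v)) j‖ ≤
          ‖φ‖ * ‖b - v‖ := by
        rw [fourierCoeff, fourierCoeff, ← integral_sub (hint _ hcont) (hint _ (halg v hv).1)]
        refine (norm_integral_le_of_norm_le_const (C := ‖φ‖ * ‖b - v‖)
          (Filter.Eventually.of_forall fun t => ?_)).trans ?_
        · rw [← smul_sub, norm_smul]
          have : ‖(fourier (-j) t : ℂ)‖ = 1 := Circle.norm_coe _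
          rw [this, one_mul]
          exact hdiff v t
        · simp
      have h2 : ‖φ (P j v) - φ (P j b)‖ ≤ ‖φ ∘L P j‖ * ‖b - v‖ := by
        rw [norm_sub_rev, ← map_sub, ← map_sub]
        exact (φ ∘L P j).le_opNorm _
      rw [(halg v hv).2 j] at h1
      rw [dist_eq_norm]
      have := norm_sub_le_norm_sub_add_norm_sub (fourierCoeff (fun t => φ (α t b)) j) (φ (P j v))
        (φ (P j b))
      nlinarith
    rw [e]
    exact hφD _ (hPb j)
  -- All coefficients vanish, so the Fourier series is trivially summable and its sum, the orbit
  -- function, is zero. Its value at `0` is `φ b`, a contradiction.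
  have hsum := hasSum_fourier_series_of_summable
    (f := (⟨fun t => φ (α t b), hcont⟩ : C(AddCircle (1 : ℝ), ℂ)))
    (by
      have : fourierCoeff (fun t => φ (α t b)) = 0 := funext hcoef
      change Summable (fourierCoeff (fun t => φ (α t b)))
      rw [this]; exact summable_zero)
  have hz : (⟨fun t => φ (α t b), hcont⟩ : C(AddCircle (1 : ℝ), ℂ)) = 0 := by
    refine hsum.unique ?_
    have : (fun i => fourierCoeff (⇑(⟨fun t => φ (α t b), hcont⟩ : C(AddCircle (1 : ℝ), ℂ))) i •
        (fourier i : C(AddCircle (1 : ℝ), ℂ))) = fun _ => 0 := by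
      ext1 i
      have : fourierCoeff (⇑(⟨fun t => φ (α t b), hcont⟩ : C(AddCircle (1 : ℝ), ℂ))) i = 0 := hcoef i
      rw [this, zero_smul]
    rw [this]
    exact hasSum_zero
  have := congrArg (fun g : C(AddCircle (1 : ℝ), ℂ) => g 0) hz
  simp only [ContinuousMap.coe_mk, ContinuousMap.zero_apply, hα0] at this
  exact hφb this

/-! ### Matrices -/

theorem Mat.ext_basisVec {Y : Type*} {F : Type*} [NormedAddCommGroup F] [NormedSpace ℂ F]
    {a b : Hil Y →L[ℂ] F} (h : ∀ y, a (basisVec y) = b (basisVec y)) : a = b := by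
  classical
  refine lp.ext_continuousLinearMap (by norm_num) fun i => ?_
  ext
  have := h i
  simp only [basisVec] at this
  simp only [ContinuousLinearMap.comp_apply, lp.singleContinuousLinearMap_apply]
  convert this

theorem norm_basisVec {Y : Type*} (y : Y) : ‖(basisVec y : Hil Y)‖ = 1 :=
  (orthonormal_basisVec Y).1 y

theorem inner_basisVec_basisVec {Y : Type*} (x y : Y) [Decidable (x = y)] :
    ⟪(basisVec x : Hil Y), basisVec y⟫_ℂ = if x = y then 1 else 0 := by
  classical
  rw [orthonormal_iff_ite.1 (orthonormal_basisVec Y)]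
  congr

theorem Mat.ext_inner {Y : Type*} {a b : Mat Y}
    (h : ∀ x y, ⟪basisVec x, a (basisVec y)⟫_ℂ = ⟪basisVec x, b (basisVec y)⟫_ℂ) : a = b := by
  refine Mat.ext_basisVec fun y => ?_
  ext x
  rw [← inner_basisVec_left, h, inner_basisVec_left]

theorem adjoint_diagOp {Y : Type*} (g : Y → ℂ) {C : ℝ} (hC : 0 ≤ C) (hg : ∀ x, ‖g x‖ ≤ C) :
    ContinuousLinearMap.adjoint (diagOp g hC hg) =
      diagOp (fun x => star (g x)) hC (fun x => by simpa using hg x) := by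
  classical
  refine Mat.ext_inner fun x y => ?_
  rw [ContinuousLinearMap.adjoint_inner_right, diagOp_basisVec, diagOp_basisVec, inner_smul_left,
    inner_smul_right, inner_basisVec_basisVec]
  split_ifs with h
  · simp [h]
  · simp

theorem norm_diagOp_le {Y : Type*} (g : Y → ℂ) {C : ℝ} (hC : 0 ≤ C) (hg : ∀ x, ‖g x‖ ≤ C) :
    ‖diagOp g hC hg‖ ≤ C :=
  lp.norm_mapCLM_le ..

theorem shift_basisVec (n k : ℤ) : shift n (basisVec k) = basisVec (n + k) :=
  pushIso_basisVec _ (add_right_injective n) _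

theorem shift_comp (m n : ℤ) : shift m ∘L shift n = shift (m + n) :=
  Mat.ext_basisVec fun k => by
    rw [ContinuousLinearMap.comp_apply, shift_basisVec, shift_basisVec, shift_basisVec, add_assoc]

theorem shift_zero : shift 0 = ContinuousLinearMap.id ℂ _ :=
  Mat.ext_basisVec fun k => by rw [shift_basisVec]; simp

theorem adjoint_shift (n : ℤ) : ContinuousLinearMap.adjoint (shift n) = shift (-n) := by
  classical
  refine Mat.ext_inner fun x y => ?_
  rw [ContinuousLinearMap.adjoint_inner_right, shift_basisVec, shift_basisVec,
    inner_basisVec_basisVec, inner_basisVec_basisVec]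
  congr 1
  simp only [eq_iff_iff]
  omega

/-! ### Operators on the Hilbert space tensor product -/

namespace HTensor

variable {H K : Type*} [NormedAddCommGroup H] [InnerProductSpace ℂ H]
  [NormedAddCommGroup K] [InnerProductSpace ℂ K]

theorem ext_tmul {F : Type*} [NormedAddCommGroup F] [NormedSpace ℂ F]
    {S T : HTensor H K →L[ℂ] F}
    (h : ∀ v w, S (incl (v ⊗ₜ[ℂ] w)) = T (incl (v ⊗ₜ[ℂ] w))) : S = T := by
  refine ContinuousLinearMap.coeFn_injective
    (denseRange_incl.equalizer S.continuous T.continuous (funext fun z => ?_))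
  simp only [Function.comp]
  induction z using TensorProduct.induction_on with
  | zero => rw [show incl (0 : H ⊗[ℂ] K) = 0 from UniformSpace.Completion.coe_zero, map_zero, map_zero]
  | tmul v w => exact h v w
  | add z w hz hw => rw [incl_add, map_add, map_add, hz, hw]

theorem map_comp_map (a a' : H →L[ℂ] H) (b b' : K →L[ℂ] K) :
    map a b ∘L map a' b' = map (a ∘L a') (b ∘L b') :=
  ext_tmul fun v w => by
    simp only [ContinuousLinearMap.comp_apply, map_tmul]

theorem inner_incl_tmul (v v' : H) (w w' : K) :
    ⟪incl (v ⊗ₜ[ℂ] w), incl (v' ⊗ₜ[ℂ] w')⟫_ℂ = ⟪v, v'⟫_ℂ * ⟪w, w'⟫_ℂ := by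
  rw [inner_incl, TensorProduct.inner_tmul]

theorem adjoint_map [CompleteSpace H] [CompleteSpace K] (a : H →L[ℂ] H) (b : K →L[ℂ] K) :
    ContinuousLinearMap.adjoint (map a b) =
      map (ContinuousLinearMap.adjoint a) (ContinuousLinearMap.adjoint b) := by
  refine ext_tmul fun v w => ?_
  refine ext_inner_right ℂ fun z => ?_
  rw [← innerSL_apply_apply ℂ, ← innerSL_apply_apply ℂ]
  congr 1
  refine ext_tmul fun v' w' => ?_
  rw [innerSL_apply_apply, innerSL_apply_apply, ContinuousLinearMap.adjoint_inner_left, map_tmul,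
    map_tmul, inner_incl_tmul, inner_incl_tmul, ContinuousLinearMap.adjoint_inner_left,
    ContinuousLinearMap.adjoint_inner_left]

theorem norm_map_le (a : H →L[ℂ] H) (b : K →L[ℂ] K) : ‖map a b‖ ≤ ‖a‖ * ‖b‖ := by
  refine ContinuousLinearMap.opNorm_le_bound _ (by positivity) fun z => ?_
  refine denseRange_incl.induction_on z
    (isClosed_le (map a b).continuous.norm (continuous_const.mul continuous_norm)) fun z => ?_
  rw [map_incl]
  have e : ∀ y : H ⊗[ℂ] K, ‖incl y‖ = ‖y‖ := fun y => UniformSpace.Completion.norm_coe y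
  rw [e, e]
  exact ((TensorProduct.mapL a b).le_opNorm z).trans
    (mul_le_mul_of_nonneg_right (TensorProduct.norm_mapL_le a b) (norm_nonneg _))

/-- The operator `v ↦ v ⊗ w`. -/
def tmulRight (w : K) : H →L[ℂ] HTensor H K :=
  LinearMap.mkContinuous
    { toFun := fun v => incl (v ⊗ₜ[ℂ] w)
      map_add' := fun v v' => by rw [TensorProduct.add_tmul, incl_add]
      map_smul' := fun c v => by
        rw [← TensorProduct.smul_tmul', incl_smul, RingHom.id_apply] } ‖w‖ (fun v => by
    have e : ∀ y : H ⊗[ℂ] K, ‖incl y‖ = ‖y‖ := fun y => UniformSpace.Completion.norm_coe y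
    simp only [LinearMap.coe_mk, AddHom.coe_mk]
    rw [e, TensorProduct.norm_tmul, mul_comm])

theorem tmulRight_apply (w : K) (v : H) : tmulRight w v = incl (v ⊗ₜ[ℂ] w) := rfl

theorem map_comp_tmulRight (a : H →L[ℂ] H) (b : K →L[ℂ] K) (w : K) :
    map a b ∘L tmulRight w = tmulRight (b w) ∘L a := by
  ext1 v
  simp only [ContinuousLinearMap.comp_apply, tmulRight_apply, map_tmul]

theorem adjoint_tmulRight_comp_tmulRight [CompleteSpace H] (w w' : K) :
    ContinuousLinearMap.adjoint (tmulRight (H := H) w) ∘L tmulRight w' =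
      ⟪w, w'⟫_ℂ • ContinuousLinearMap.id ℂ H := by
  ext1 v
  refine ext_inner_left ℂ fun v' => ?_
  rw [ContinuousLinearMap.comp_apply, ContinuousLinearMap.adjoint_inner_right, tmulRight_apply,
    tmulRight_apply, inner_incl_tmul, smul_apply, ContinuousLinearMap.id_apply, inner_smul_right,
    mul_comm]

end HTensor

/-! ### The `ℤ`-grading: Fourier coefficients and the gauge action -/

section TensorShift

variable {Y : Type*}

theorem tensorShift_apply (n : ℤ) (a : Mat Y) : tensorShift Y n a = HTensor.map a (shift n) := rfl

theorem tensorShift_mul (m n : ℤ) (a b : Mat Y) :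
    tensorShift Y m a * tensorShift Y n b = tensorShift Y (m + n) (a * b) := by
  rw [tensorShift_apply, tensorShift_apply, tensorShift_apply, ← shift_comp]
  exact HTensor.map_comp_map _ _ _ _

theorem star_tensorShift (n : ℤ) (a : Mat Y) :
    star (tensorShift Y n a) = tensorShift Y (-n) (star a) := by
  rw [tensorShift_apply, tensorShift_apply, ContinuousLinearMap.star_eq_adjoint,
    ContinuousLinearMap.star_eq_adjoint, HTensor.adjoint_map, adjoint_shift]

theorem tensorShift_zero_one : tensorShift Y 0 1 = 1 := by
  refine HTensor.ext_tmul fun v w => ?_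
  rw [tensorShift_apply, HTensor.map_tmul, shift_zero]
  rfl

theorem norm_tensorShift_le (n : ℤ) (a : Mat Y) : ‖tensorShift Y n a‖ ≤ ‖a‖ := by
  refine (HTensor.norm_map_le _ _).trans ?_
  refine mul_le_of_le_one_right (norm_nonneg _) ?_
  exact LinearIsometry.norm_toContinuousLinearMap_le _

theorem continuous_tensorShift (n : ℤ) : Continuous (tensorShift Y n) :=
  AddMonoidHomClass.continuous_of_bound (tensorShift Y n) 1 fun a => by
    rw [one_mul]; exact norm_tensorShift_le n a

/-- The coefficient of an operator at the shift by `k`. -/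
def coeff (Y : Type*) (k : ℤ) : HatMat Y →L[ℂ] Mat Y :=
  (ContinuousLinearMap.compL ℂ (Hil Y) (HTensor (Hil Y) (Hil ℤ)) (Hil Y)
    (ContinuousLinearMap.adjoint (HTensor.tmulRight (basisVec k)))) ∘L
  ((ContinuousLinearMap.compL ℂ (Hil Y) (HTensor (Hil Y) (Hil ℤ))
    (HTensor (Hil Y) (Hil ℤ))).flip (HTensor.tmulRight (basisVec 0)))

theorem coeff_apply (k : ℤ) (b : HatMat Y) :
    coeff Y k b = ContinuousLinearMap.adjoint (HTensor.tmulRight (basisVec k)) ∘L b ∘L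
      HTensor.tmulRight (basisVec 0) := rfl

/-- The shift sends `e_0` to `e_n`, which is orthogonal to `e_k` unless `n = k`. -/
theorem coeff_tensorShift (k n : ℤ) (a : Mat Y) :
    coeff Y k (tensorShift Y n a) = if n = k then a else 0 := by
  rw [coeff_apply, tensorShift_apply, HTensor.map_comp_tmulRight, shift_basisVec, add_zero,
    ← ContinuousLinearMap.comp_assoc, HTensor.adjoint_tmulRight_comp_tmulRight,
    inner_basisVec_basisVec]
  simp only [eq_comm (a := n)]
  split_ifs
  · rw [one_smul, ContinuousLinearMap.id_comp]
  · rw [zero_smul, ContinuousLinearMap.zero_comp]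

/-- With `coeff_tensorShift_zero_mul`, this makes `coeff` a bimodule map over degree `0`, so that
commuting with `ρ̂_A(A)` passes to every coefficient. -/
theorem coeff_mul_tensorShift_zero (k : ℤ) (b : HatMat Y) (a : Mat Y) :
    coeff Y k (b * tensorShift Y 0 a) = coeff Y k b * a := by
  rw [coeff_apply, coeff_apply, ContinuousLinearMap.mul_def, ContinuousLinearMap.mul_def,
    ContinuousLinearMap.comp_assoc, tensorShift_apply, HTensor.map_comp_tmulRight, shift_basisVec,
    add_zero]
  rfl

theorem coeff_tensorShift_zero_mul (k : ℤ) (b : HatMat Y) (a : Mat Y) :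
    coeff Y k (tensorShift Y 0 a * b) = a * coeff Y k b := by
  have h : ContinuousLinearMap.adjoint (HTensor.tmulRight (H := Hil Y) (basisVec k)) ∘L
      HTensor.map a (shift 0) =
      a ∘L ContinuousLinearMap.adjoint (HTensor.tmulRight (basisVec k)) := by
    have := HTensor.map_comp_tmulRight (ContinuousLinearMap.adjoint a) (shift 0) (basisVec k)
    rw [shift_basisVec, zero_add] at this
    have h2 := congrArg ContinuousLinearMap.adjoint this
    rwa [ContinuousLinearMap.adjoint_comp, ContinuousLinearMap.adjoint_comp,
      ContinuousLinearMap.adjoint_adjoint, HTensor.adjoint_map,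
      ContinuousLinearMap.adjoint_adjoint, adjoint_shift, neg_zero] at h2
  rw [coeff_apply, coeff_apply, ContinuousLinearMap.mul_def, ContinuousLinearMap.mul_def,
    tensorShift_apply, ← ContinuousLinearMap.comp_assoc, ← ContinuousLinearMap.comp_assoc, h]
  rfl

/-- The diagonal unitary `e_k ↦ exp (2 π i k t) e_k`. -/
def phase (t : AddCircle (1 : ℝ)) : Mat ℤ :=
  diagOp (fun k => fourier k t) zero_le_one (fun _ => (Circle.norm_coe _).le)

theorem phase_basisVec (t : AddCircle (1 : ℝ)) (k : ℤ) :
    phase t (basisVec k) = (fourier k t : ℂ) • basisVec k := diagOp_basisVec ..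

/-- On `e_k` the two phases contribute the characters of `-k` and `n + k`, whose product does not
depend on `k`. -/
theorem phase_comp_shift_comp_phase (t : AddCircle (1 : ℝ)) (n : ℤ) :
    phase t ∘L shift n ∘L phase (-t) = (fourier n t : ℂ) • shift n := by
  refine Mat.ext_basisVec fun k => ?_
  simp only [ContinuousLinearMap.comp_apply, phase_basisVec, map_smul, shift_basisVec,
    smul_apply, smul_smul]
  congr 1
  rw [fourier_add, show (fourier k (-t) : ℂ) = fourier (-k) t by simp [fourier_apply], mul_comm,
    mul_assoc, ← fourier_add]
  simp

theorem phase_zero : phase 0 = ContinuousLinearMap.id ℂ _ :=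
  Mat.ext_basisVec fun k => by simp [phase_basisVec]

/-- Conjugation by `1 ⊗ phase t`. -/
def gauge (Y : Type*) (t : AddCircle (1 : ℝ)) : HatMat Y →L[ℂ] HatMat Y :=
  (ContinuousLinearMap.mul ℂ (HatMat Y) (HTensor.map (.id ℂ _) (phase t))) ∘L
    ((ContinuousLinearMap.mul ℂ (HatMat Y)).flip (HTensor.map (.id ℂ _) (phase (-t))))

theorem gauge_apply (t : AddCircle (1 : ℝ)) (b : HatMat Y) :
    gauge Y t b = HTensor.map (.id ℂ _) (phase t) * (b * HTensor.map (.id ℂ _) (phase (-t))) := rfl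

theorem norm_gauge_le (t : AddCircle (1 : ℝ)) (b : HatMat Y) : ‖gauge Y t b‖ ≤ ‖b‖ := by
  have h : ∀ t, ‖(HTensor.map (.id ℂ _) (phase t) : HatMat Y)‖ ≤ 1 := fun t =>
    (HTensor.norm_map_le _ _).trans
      (mul_le_one₀ ContinuousLinearMap.norm_id_le (norm_nonneg _) (norm_diagOp_le _ _ _))
  rw [gauge_apply]
  refine (norm_mul_le _ _).trans ((mul_le_of_le_one_left (norm_nonneg _) (h _)).trans ?_)
  exact (norm_mul_le _ _).trans (mul_le_of_le_one_right (norm_nonneg _) (h _))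

theorem gauge_zero (b : HatMat Y) : gauge Y 0 b = b := by
  have : (HTensor.map (.id ℂ _) (.id ℂ _) : HatMat Y) = 1 :=
    HTensor.ext_tmul fun v w => by rw [HTensor.map_tmul]; rfl
  rw [gauge_apply, neg_zero, phase_zero, this, one_mul, mul_one]

theorem gauge_tensorShift (t : AddCircle (1 : ℝ)) (n : ℤ) (a : Mat Y) :
    gauge Y t (tensorShift Y n a) = (fourier n t : ℂ) • tensorShift Y n a := by
  rw [gauge_apply, tensorShift_apply, ContinuousLinearMap.mul_def, ContinuousLinearMap.mul_def,
    HTensor.map_comp_map, HTensor.map_comp_map, phase_comp_shift_comp_phase]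
  refine HTensor.ext_tmul fun v w => ?_
  rw [smul_apply, HTensor.map_tmul, HTensor.map_tmul, ← HTensor.incl_smul, smul_apply,
    TensorProduct.tmul_smul]
  rfl

/-- An operator in the closed span of operators `α ⊗ υ_k` belongs to every closed subspace that
contains all its components. -/
theorem mem_of_tensorShift_coeff_mem (V : ℤ → Submodule ℂ (Mat Y)) (D : Submodule ℂ (HatMat Y))
    (hD : IsClosed (D : Set (HatMat Y))) {b : HatMat Y}
    (hb : b ∈ (⨆ k, (V k).map (tensorShift Y k)).topologicalClosure)
    (hPb : ∀ k, tensorShift Y k (coeff Y k b) ∈ D) : b ∈ D := by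
  refine mem_of_components_mem (gauge Y) norm_gauge_le gauge_zero
    (fun k => (⟨tensorShift Y k, continuous_tensorShift k⟩ : Mat Y →L[ℂ] HatMat Y) ∘L coeff Y k)
    (fun k => (V k).map (tensorShift Y k)) ?_ ?_ D hD hb hPb
  · rintro t k _ ⟨a, -, rfl⟩
    exact gauge_tensorShift t k a
  · rintro j k _ ⟨a, -, rfl⟩
    change tensorShift Y j (coeff Y j (tensorShift Y k a)) = _
    rw [coeff_tensorShift]
    split_ifs with h
    · rw [h]
    · rw [map_zero]

end TensorShift

/-! ### Truncation of bichains -/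

section Bichains

variable {X : Type*} [TopologicalSpace X] {N : ℕ} {γ : Fin N → C(X, X)}

theorem path_castSucc (γ : Fin N → C(X, X)) {n : ℕ} (k : Fin (n + 1) → Fin N) (x : X)
    (i : Fin (n + 1)) : path γ k x i.castSucc = path γ (Fin.init k) x i := by
  induction i using Fin.induction with
  | zero => rfl
  | succ i ih =>
    rw [path_succ, ← ih, ← Fin.succ_castSucc, path_succ]
    rfl

theorem comp_succ (γ : Fin N → C(X, X)) {n : ℕ} (k : Fin (n + 1) → Fin N) (x : X) :
    comp γ k x = γ (k (Fin.last n)) (comp γ (Fin.init k) x) := by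
  rw [comp, comp, ← Fin.succ_last, path_succ, path_castSucc]

/-- The bichain without its top left point. -/
def truncLeft (γ : Fin N → C(X, X)) (m n : ℕ) : C(Bichain γ (m + 1) n, Bichain γ m n) where
  toFun z := ⟨(fun i => z.1.1 i.castSucc, z.1.2), fun i => by
    obtain ⟨k, hk⟩ := z.2.1 i.castSucc
    exact ⟨k, by simpa using hk⟩, z.2.2.1, z.2.2.2⟩
  continuous_toFun := by
    refine Continuous.subtype_mk (Continuous.prodMk (continuous_pi fun i => ?_) (by fun_prop)) _
    exact (continuous_apply _).comp (continuous_fst.comp continuous_subtype_val)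

/-- The top left edge of a bichain. -/
def edgeLeft (γ : Fin N → C(X, X)) (m n : ℕ) : C(Bichain γ (m + 1) n, Graph γ) where
  toFun z := ⟨(z.1.1 (Fin.last (m + 1)), z.1.1 (Fin.last m).castSucc), by
    obtain ⟨k, hk⟩ := z.2.1 (Fin.last m)
    exact Set.mem_iUnion.2 ⟨k, hk⟩⟩
  continuous_toFun := by
    refine Continuous.subtype_mk (Continuous.prodMk ?_ ?_) _ <;>
    exact (continuous_apply _).comp (continuous_fst.comp continuous_subtype_val)

/-- The top left point of a bichain. -/
def topLeft (γ : Fin N → C(X, X)) (m n : ℕ) : C(Bichain γ m n, X) where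
  toFun z := z.1.1 (Fin.last m)
  continuous_toFun := (continuous_apply _).comp (continuous_fst.comp continuous_subtype_val)

/-- The exchange of the two chains of a bichain. -/
def bichainSwap (γ : Fin N → C(X, X)) (m n : ℕ) : C(Bichain γ m n, Bichain γ n m) where
  toFun z := ⟨(z.1.2, z.1.1), z.2.2.1, z.2.1, z.2.2.2.symm⟩
  continuous_toFun := by
    refine Continuous.subtype_mk (Continuous.prodMk ?_ ?_) _ <;> fun_prop

theorem continuous_path (γ : Fin N → C(X, X)) {n : ℕ} (k : Fin n → Fin N) :
    Continuous fun x => path γ k x := by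
  refine continuous_pi fun i => ?_
  induction i using Fin.induction with
  | zero => exact continuous_id
  | succ i ih => simp only [path_succ]; exact (γ (k i)).continuous.comp ih

theorem continuous_bichainAt (γ : Fin N → C(X, X)) {m n : ℕ} (j : Fin m → Fin N)
    (k : Fin n → Fin N) : Continuous (bichainAt γ j k) :=
  Continuous.subtype_mk ((continuous_path γ j).prodMk (continuous_path γ k)) _

theorem truncLeft_bichainAt {m n : ℕ} (j : Fin (m + 1) → Fin N) (k : Fin n → Fin N) (x : X) :
    truncLeft γ m n (bichainAt γ j k x) = bichainAt γ (Fin.init j) k x :=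
  Subtype.ext (Prod.ext (funext fun i => path_castSucc γ j x i) rfl)

theorem edgeLeft_bichainAt {m n : ℕ} (j : Fin (m + 1) → Fin N) (k : Fin n → Fin N) (x : X) :
    edgeLeft γ m n (bichainAt γ j k x) =
      graphPt γ (j (Fin.last m)) (comp γ (Fin.init j) x) :=
  Subtype.ext (Prod.ext (comp_succ γ j x) (path_castSucc γ j x _))

end Bichains

/-- The span of a set of continuous functions that is closed under products and conjugation,
contains `1` and separates points is dense. -/
theorem closure_span_eq_top_of_separatesPoints {Z : Type*} [TopologicalSpace Z] [CompactSpace Z]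
    (M : Submonoid C(Z, ℂ)) (hstar : ∀ f ∈ M, star f ∈ M)
    (hsep : ∀ x y : Z, x ≠ y → ∃ f ∈ M, f x ≠ f y) :
    (Submodule.span ℂ (M : Set C(Z, ℂ))).topologicalClosure = ⊤ := by
  -- A multiplicatively closed set spans its own generated algebra, so Stone–Weierstrass applies to
  -- the linear span.
  have hadj : (Algebra.adjoin ℂ (M : Set C(Z, ℂ))).toSubmodule =
      Submodule.span ℂ (M : Set C(Z, ℂ)) := by
    rw [Algebra.adjoin_eq_span, Submonoid.closure_eq]
  have hstarM : star (M : Set C(Z, ℂ)) = M := by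
    ext f
    rw [Set.mem_star]
    exact ⟨fun h => by simpa using hstar _ h, fun h => hstar _ h⟩
  let A : StarSubalgebra ℂ C(Z, ℂ) := StarAlgebra.adjoin ℂ (M : Set C(Z, ℂ))
  have hA : A.toSubalgebra = Algebra.adjoin ℂ (M : Set C(Z, ℂ)) := by
    rw [StarAlgebra.adjoin_toSubalgebra, hstarM, Set.union_self]
  have htop := ContinuousMap.starSubalgebra_topologicalClosure_eq_top_of_separatesPoints A (by
    intro x y hxy
    obtain ⟨f, hf, h⟩ := hsep x y hxy
    exact ⟨f, ⟨f, StarAlgebra.subset_adjoin ℂ _ hf, rfl⟩, h⟩)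
  rw [eq_top_iff]
  intro f _
  have hf : f ∈ A.topologicalClosure := by rw [htop]; trivial
  have hset : (A : Set C(Z, ℂ)) = (Submodule.span ℂ (M : Set C(Z, ℂ)) : Set C(Z, ℂ)) := by
    rw [← hadj, ← hA]; rfl
  change f ∈ closure (Submodule.span ℂ (M : Set C(Z, ℂ)) : Set C(Z, ℂ))
  rw [← hset]
  exact hf

theorem exists_continuous_apply_ne {X : Type*} [TopologicalSpace X] [CompactSpace X] [T2Space X]
    {x y : X} (hxy : x ≠ y) : ∃ a : C(X, ℂ), a x ≠ a y := by
  obtain ⟨f, hf0, hf1, -⟩ := exists_continuous_zero_one_of_isClosed (isClosed_singleton (x := x))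
    (isClosed_singleton (x := y)) (by simpa using hxy)
  refine ⟨⟨fun z => (f z : ℂ), by fun_prop⟩, ?_⟩
  simp [hf0 rfl, hf1 rfl]

/-! ### Products and adjoints of the representations -/

namespace Admissible

variable {X : Type*} [TopologicalSpace X] {N : ℕ} {γ : Fin N → C(X, X)} {S : Set X}

theorem compS_succ (h : Admissible γ S) {n : ℕ} (k : Fin (n + 1) → Fin N) (x : S) :
    h.compS k x = h.gamS (k (Fin.last n)) (h.compS (Fin.init k) x) :=
  Subtype.ext (comp_succ γ k x)

theorem compS_zero (h : Admissible γ S) (k : Fin 0 → Fin N) (x : S) : h.compS k x = x := rfl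

theorem gamS_eq (h : Admissible γ S) {i j : Fin N} {x y : S} (hxy : h.gamS i x = h.gamS j y) :
    i = j ∧ x = y := by
  have hij : i = j := by
    by_contra hne
    exact (h.disjoint hne).ne_of_mem ⟨x, x.2, rfl⟩ ⟨y, y.2, rfl⟩ (congrArg Subtype.val hxy)
  subst hij
  exact ⟨rfl, h.gamS_injective i hxy⟩

theorem norm_compOp_le (h : Admissible γ S) {n : ℕ} (k : Fin n → Fin N) : ‖h.compOp k‖ ≤ 1 :=
  LinearIsometry.norm_toContinuousLinearMap_le _

theorem ext_rhoMN (h : Admissible γ S) {n : ℕ} {a b : Mat S}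
    (h1 : ∀ (k : Fin n → Fin N) x, a (basisVec (h.compS k x)) = b (basisVec (h.compS k x)))
    (h2 : ∀ y, (∀ (k : Fin n → Fin N) x, h.compS k x ≠ y) → a (basisVec y) = b (basisVec y)) :
    a = b := by
  refine Mat.ext_basisVec fun y => ?_
  by_cases hy : ∃ (k : Fin n → Fin N) (x : S), h.compS k x = y
  · obtain ⟨k, x, rfl⟩ := hy
    exact h1 k x
  · exact h2 y fun k x hkx => hy ⟨k, x, hkx⟩

variable [CompactSpace X]

theorem rhoA_one (h : Admissible γ S) : h.rhoA 1 = 1 :=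
  Mat.ext_basisVec fun y => by rw [rhoA_basisVec]; simp

theorem star_rhoA (h : Admissible γ S) (a : C(X, ℂ)) : star (h.rhoA a) = h.rhoA (star a) :=
  adjoint_diagOp ..

variable [T2Space X]

theorem norm_coeffOp_le (h : Admissible γ S) {m n : ℕ} (f : C(Bichain γ m n, ℂ))
    (j : Fin m → Fin N) (k : Fin n → Fin N) : ‖h.coeffOp f j k‖ ≤ ‖f‖ :=
  norm_diagOp_le ..

theorem norm_rhoMN_le (h : Admissible γ S) (m n : ℕ) (f : C(Bichain γ m n, ℂ)) :
    ‖h.rhoMN m n f‖ ≤ (∑ _j : Fin m → Fin N, ∑ _k : Fin n → Fin N, (1 : ℝ)) * ‖f‖ := by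
  rw [rhoMN_apply, Finset.sum_mul]
  refine norm_sum_le_of_le _ fun j _ => ?_
  rw [Finset.sum_mul]
  refine norm_sum_le_of_le _ fun k _ => ?_
  have h1 : ‖ContinuousLinearMap.adjoint (h.compOp k)‖ ≤ 1 := by
    rw [LinearIsometryEquiv.norm_map]; exact h.norm_compOp_le k
  calc _ ≤ ‖h.compOp j‖ * ‖h.coeffOp f j k ∘L ContinuousLinearMap.adjoint (h.compOp k)‖ :=
        ContinuousLinearMap.opNorm_comp_le _ _
    _ ≤ 1 * ‖h.coeffOp f j k ∘L ContinuousLinearMap.adjoint (h.compOp k)‖ :=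
        mul_le_mul_of_nonneg_right (h.norm_compOp_le j) (norm_nonneg _)
    _ ≤ 1 * (‖h.coeffOp f j k‖ * ‖ContinuousLinearMap.adjoint (h.compOp k)‖) :=
        mul_le_mul_of_nonneg_left (ContinuousLinearMap.opNorm_comp_le _ _) zero_le_one
    _ ≤ 1 * (‖f‖ * 1) := mul_le_mul_of_nonneg_left
        (mul_le_mul (h.norm_coeffOp_le f j k) h1 (norm_nonneg _) (norm_nonneg _)) zero_le_one
    _ = 1 * ‖f‖ := by rw [mul_one]

theorem continuous_rhoMN (h : Admissible γ S) (m n : ℕ) : Continuous (h.rhoMN m n) :=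
  AddMonoidHomClass.continuous_of_bound (h.rhoMN m n) _ (h.norm_rhoMN_le m n)

/-- Applying `ρ_E(f)` adds one edge at the top of the left chain; the new coefficient is the product
of `f` on that edge and `g` on the truncated bichain. -/
theorem rhoE_mul_rhoMN (h : Admissible γ S) {m n : ℕ} (f : C(Graph γ, ℂ))
    (g : C(Bichain γ m n, ℂ)) :
    h.rhoE f * h.rhoMN m n g =
      h.rhoMN (m + 1) n (f.comp (edgeLeft γ m n) * g.comp (truncLeft γ m n)) := by
  refine h.ext_rhoMN (n := n) (fun k x => ?_) (fun y hy => ?_)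
  · rw [ContinuousLinearMap.mul_def, ContinuousLinearMap.comp_apply, rhoMN_basisVec, rhoMN_basisVec, map_sum]
    simp only [map_smul, rhoE_basisVec, Finset.smul_sum, smul_smul]
    -- An index sequence of length `m + 1` is split into its last index and its initial part.
    rw [← Finset.sum_product',
      ← (Fin.snocEquiv fun _ : Fin (m + 1) => Fin N).sum_comp, ← Finset.univ_product_univ,
      Finset.sum_product_right]
    rw [Finset.sum_product]
    refine Finset.sum_congr rfl fun j _ => Finset.sum_congr rfl fun i _ => ?_
    have hi : Fin.init ((Fin.snocEquiv fun _ : Fin (m + 1) => Fin N) (j, i)) = i :=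
      Fin.init_snoc (α := fun _ => Fin N) j i
    have hl : (Fin.snocEquiv fun _ : Fin (m + 1) => Fin N) (j, i) (Fin.last m) = j :=
      Fin.snoc_last (α := fun _ => Fin N) j i
    simp only [ContinuousMap.mul_apply, ContinuousMap.comp_apply, truncLeft_bichainAt,
      edgeLeft_bichainAt, compS_succ, hi, hl]
    rw [mul_comm]
    rfl
  · rw [ContinuousLinearMap.mul_def, ContinuousLinearMap.comp_apply, rhoMN_basisVec_of_notMem h g y hy, rhoMN_basisVec_of_notMem h _ y hy,
      map_zero]

theorem rhoA_mul_rhoMN (h : Admissible γ S) {m n : ℕ} (a : C(X, ℂ)) (g : C(Bichain γ m n, ℂ)) :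
    h.rhoA a * h.rhoMN m n g = h.rhoMN m n (a.comp (topLeft γ m n) * g) := by
  refine h.ext_rhoMN (n := n) (fun k x => ?_) (fun y hy => ?_)
  · rw [ContinuousLinearMap.mul_def, ContinuousLinearMap.comp_apply, rhoMN_basisVec, rhoMN_basisVec, map_sum]
    refine Finset.sum_congr rfl fun j _ => ?_
    rw [map_smul, rhoA_basisVec, smul_smul, mul_comm]
    rfl
  · rw [ContinuousLinearMap.mul_def, ContinuousLinearMap.comp_apply, rhoMN_basisVec_of_notMem h g y hy, rhoMN_basisVec_of_notMem h _ y hy,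
      map_zero]

theorem rhoMN_zero_zero (h : Admissible γ S) (a : C(X, ℂ)) :
    h.rhoMN 0 0 (a.comp (topLeft γ 0 0)) = h.rhoA a := by
  refine h.ext_rhoMN (n := 0) (fun k x => ?_) (fun y hy => absurd rfl (hy Fin.elim0 y))
  rw [rhoMN_basisVec, rhoA_basisVec, Fintype.sum_unique]
  rfl

/-- A bichain of length `(0, 0)` is just its common starting point, so `E_{0,0}` is `ρ_A(A)`. -/
theorem rhoMN_zero_zero_eq (h : Admissible γ S) (f : C(Bichain γ 0 0, ℂ)) :
    h.rhoMN 0 0 f = h.rhoA (f.comp ⟨_, continuous_bichainAt γ Fin.elim0 Fin.elim0⟩) := by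
  rw [← rhoMN_zero_zero]
  congr 1
  ext z
  simp only [ContinuousMap.comp_apply, ContinuousMap.coe_mk]
  congr 1
  refine Subtype.ext (Prod.ext (funext fun i => ?_) (funext fun i => ?_))
  · rw [show i = 0 from Fin.fin_one_eq_zero i]; rfl
  · rw [show i = 0 from Fin.fin_one_eq_zero i]; exact z.2.2.2.symm

theorem star_rhoMN (h : Admissible γ S) {m n : ℕ} (f : C(Bichain γ m n, ℂ)) :
    star (h.rhoMN m n f) = h.rhoMN n m (star f |>.comp (bichainSwap γ n m)) := by
  rw [rhoMN_apply, rhoMN_apply, star_sum, Finset.sum_comm]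
  simp only [star_sum]
  refine Finset.sum_congr rfl fun k _ => ?_
  refine Finset.sum_congr rfl fun j _ => ?_
  rw [ContinuousLinearMap.star_eq_adjoint, ContinuousLinearMap.adjoint_comp,
    ContinuousLinearMap.adjoint_comp, ContinuousLinearMap.adjoint_adjoint, coeffOp, adjoint_diagOp,
    ContinuousLinearMap.comp_assoc]
  rfl

/-- The images `γ_i(S)` are disjoint and each `γ_i` is injective on `S`, so all cross terms vanish
and only the diagonal sum over `i` survives. -/
theorem star_rhoE_mul_rhoE (h : Admissible γ S) (f g : C(Graph γ, ℂ)) :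
    ∃ a : C(X, ℂ), star (h.rhoE f) * h.rhoE g = h.rhoA a := by
  classical
  have hc : ∀ i, Continuous (graphPt γ i) := fun i =>
    Continuous.subtype_mk ((γ i).continuous.prodMk continuous_id) _
  refine ⟨∑ i, (star f).comp ⟨_, hc i⟩ * g.comp ⟨_, hc i⟩, Mat.ext_inner fun x y => ?_⟩
  rw [ContinuousLinearMap.mul_def, ContinuousLinearMap.comp_apply, ContinuousLinearMap.star_eq_adjoint,
    ContinuousLinearMap.adjoint_inner_right, rhoE_basisVec, rhoE_basisVec, rhoA_basisVec,
    sum_inner, inner_smul_right, inner_basisVec_basisVec, ContinuousMap.sum_apply, Finset.sum_mul]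
  refine Finset.sum_congr rfl fun i _ => ?_
  rw [inner_sum, Finset.sum_eq_single i]
  · rw [inner_smul_left, inner_smul_right, inner_basisVec_basisVec]
    simp only [(h.gamS_injective i).eq_iff]
    split_ifs with hxy
    · subst hxy; simp
    · simp
  · intro j _ hj
    rw [inner_smul_left, inner_smul_right, inner_basisVec_basisVec, if_neg, mul_zero, mul_zero]
    exact fun he => hj (h.gamS_eq he).1.symm
  · simp

/-- `E_{m+1,n}` is contained in every closed subspace that contains `ρ_E(f) E_{m,n}` for all `f`. -/
theorem rhoMN_succ_mem (h : Admissible γ S) {m n : ℕ} (V : Submodule ℂ (Mat S))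
    (hV : IsClosed (V : Set (Mat S))) (hmem : ∀ f g, h.rhoE f * h.rhoMN m n g ∈ V)
    (f : C(Bichain γ (m + 1) n, ℂ)) : h.rhoMN (m + 1) n f ∈ V := by
  let M : Submonoid C(Bichain γ (m + 1) n, ℂ) :=
    { carrier := {p | ∃ (f : C(Graph γ, ℂ)) (g : C(Bichain γ m n, ℂ)),
        f.comp (edgeLeft γ m n) * g.comp (truncLeft γ m n) = p}
      one_mem' := ⟨1, 1, by ext; simp⟩
      mul_mem' := by
        rintro _ _ ⟨f, g, rfl⟩ ⟨f', g', rfl⟩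
        exact ⟨f * f', g * g', by ext; simp; ring⟩ }
  have htop := closure_span_eq_top_of_separatesPoints M
    (by rintro _ ⟨f, g, rfl⟩; exact ⟨star f, star g, by ext; simp⟩)
    (by
      intro z w hzw
      -- Two bichains with the same top left point and the same truncation are equal; the first is
      -- seen by the edge, the second by `truncLeft`.
      by_cases hl : topLeft γ (m + 1) n z = topLeft γ (m + 1) n w
      · have ht : truncLeft γ m n z ≠ truncLeft γ m n w := by
          intro ht
          apply hzw
          refine Subtype.ext (Prod.ext (funext fun i => ?_) ?_)
          · refine Fin.lastCases hl (fun i => ?_) i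
            exact congrFun (congrArg (fun u => u.1.1) ht) i
          · exact congrArg (fun u => u.1.2) ht
        obtain ⟨g, hg⟩ := exists_continuous_apply_ne ht
        exact ⟨_, ⟨1, g, rfl⟩, by simpa using hg⟩
      · obtain ⟨a, ha⟩ := exists_continuous_apply_ne hl
        exact ⟨_, ⟨a.comp ⟨fun z => z.1.1, by fun_prop⟩, 1, rfl⟩, by simpa using! ha⟩)
  have hle : Submodule.span ℂ (M : Set C(Bichain γ (m + 1) n, ℂ)) ≤ V.comap (h.rhoMN (m + 1) n) := by
    rw [Submodule.span_le]
    rintro _ ⟨f, g, rfl⟩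
    rw [SetLike.mem_coe, Submodule.mem_comap, ← rhoE_mul_rhoMN]
    exact hmem f g
  have := Submodule.topologicalClosure_minimal _ hle (hV.preimage (h.continuous_rhoMN _ _))
  rw [htop] at this
  exact this (Submodule.mem_top (x := f))

end Admissible

/-! ### `C*(ρ̂)` as the closed span of the `B_k ⊗ υ_k` -/

namespace Admissible

variable {X : Type*} [TopologicalSpace X] [CompactSpace X] [T2Space X] {N : ℕ}
  {γ : Fin N → C(X, X)} {S : Set X}

theorem isClosed_B (h : Admissible γ S) (k : ℤ) : IsClosed (h.B k : Set (Mat S)) :=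
  Submodule.isClosed_topologicalClosure _

theorem B_le (h : Admissible γ S) {k : ℤ} {V : Submodule ℂ (Mat S)}
    (hV : IsClosed (V : Set (Mat S)))
    (hmem : ∀ m n : ℕ, (m : ℤ) - n = k → ∀ f, h.rhoMN m n f ∈ V) : h.B k ≤ V := by
  refine Submodule.topologicalClosure_minimal _ ?_ hV
  refine iSup_le fun m => iSup_le fun n => iSup_le fun hk => ?_
  rintro _ ⟨f, rfl⟩
  exact hmem m n hk f

theorem rhoMN_mem_B (h : Admissible γ S) {m n : ℕ} {k : ℤ} (hk : (m : ℤ) - n = k)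
    (f : C(Bichain γ m n, ℂ)) : h.rhoMN m n f ∈ h.B k := by
  refine Submodule.le_topologicalClosure _ ?_
  exact Submodule.mem_iSup_of_mem m (Submodule.mem_iSup_of_mem n
    (Submodule.mem_iSup_of_mem hk ⟨f, rfl⟩))

theorem closure_E_le_B (h : Admissible γ S) {m n : ℕ} {k : ℤ} (hk : (m : ℤ) - n = k) :
    (h.E m n).topologicalClosure ≤ h.B k :=
  Submodule.topologicalClosure_minimal _ (by rintro _ ⟨f, rfl⟩; exact h.rhoMN_mem_B hk f)
    (h.isClosed_B k)

theorem mul_mem_B (h : Admissible γ S) {a : Mat S} {k l : ℤ}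
    (ha : ∀ m n : ℕ, (m : ℤ) - n = k → ∀ f, a * h.rhoMN m n f ∈ h.B l) {b : Mat S}
    (hb : b ∈ h.B k) : a * b ∈ h.B l :=
  h.B_le (V := (h.B l).comap (LinearMap.mulLeft ℂ a))
    ((h.isClosed_B l).preimage (continuous_const_mul a)) ha hb

theorem rhoA_mul_mem_B (h : Admissible γ S) (a : C(X, ℂ)) {k : ℤ} {b : Mat S} (hb : b ∈ h.B k) :
    h.rhoA a * b ∈ h.B k :=
  h.mul_mem_B (fun m n hk f => by rw [rhoA_mul_rhoMN]; exact h.rhoMN_mem_B hk _) hb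

theorem rhoE_mul_mem_B (h : Admissible γ S) (f : C(Graph γ, ℂ)) {k : ℤ} {b : Mat S}
    (hb : b ∈ h.B k) : h.rhoE f * b ∈ h.B (1 + k) :=
  h.mul_mem_B (fun m n hk g => by
    rw [rhoE_mul_rhoMN]; exact h.rhoMN_mem_B (by push_cast; omega) _) hb

theorem rhoE_mul_mem_closure_E (h : Admissible γ S) (f : C(Graph γ, ℂ)) {m n : ℕ} {b : Mat S}
    (hb : b ∈ (h.E m n).topologicalClosure) :
    h.rhoE f * b ∈ (h.E (m + 1) n).topologicalClosure :=
  map_mem_closure (continuous_const_mul (h.rhoE f)) hb (by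
    rintro _ ⟨g, rfl⟩
    exact ⟨_, (h.rhoE_mul_rhoMN f g).symm⟩)

/-- Right multiplication has no direct formula here, so edges are peeled off the left factor until
`ρ_A(A)` remains. Right length `0` suffices, since only the adjoints of elements of `E_{0,n}` are
needed later. -/
theorem rhoMN_mul_rhoE_mem (h : Admissible γ S) (f : C(Graph γ, ℂ)) (m : ℕ)
    (g : C(Bichain γ m 0, ℂ)) :
    h.rhoMN m 0 g * h.rhoE f ∈ (h.E (m + 1) 0).topologicalClosure := by
  have hE : ∀ f, h.rhoE f ∈ (h.E 1 0).topologicalClosure := by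
    intro f
    have := h.rhoE_mul_rhoMN f ((1 : C(X, ℂ)).comp (topLeft γ 0 0))
    rw [rhoMN_zero_zero, rhoA_one, mul_one] at this
    rw [this]
    exact Submodule.le_topologicalClosure _ ⟨_, rfl⟩
  induction m with
  | zero =>
    rw [rhoMN_zero_zero_eq]
    refine map_mem_closure (continuous_const_mul _) (hE f) ?_
    rintro _ ⟨g, rfl⟩
    exact ⟨_, (h.rhoA_mul_rhoMN _ g).symm⟩
  | succ m ih =>
    refine h.rhoMN_succ_mem
      (V := ((h.E (m + 1 + 1) 0).topologicalClosure).comap (LinearMap.mulRight ℂ (h.rhoE f)))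
      ((Submodule.isClosed_topologicalClosure _).preimage (continuous_mul_const (h.rhoE f)))
      (fun f' g' => ?_) g
    rw [Submodule.mem_comap, LinearMap.mulRight_apply, mul_assoc]
    exact h.rhoE_mul_mem_closure_E f' (ih g')

/-- If the left chain has an edge, `ρ_E(f)*` cancels it, up to a factor in `ρ_A(A)`. If it has none,
passing to adjoints turns the product into one that lengthens the other chain, so `k = -(n + 1)`. -/
theorem star_rhoE_mul_rhoMN_mem (h : Admissible γ S) (f : C(Graph γ, ℂ)) {m n : ℕ} {k : ℤ}
    (hk : (m : ℤ) - n = 1 + k) (g : C(Bichain γ m n, ℂ)) :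
    star (h.rhoE f) * h.rhoMN m n g ∈ h.B k := by
  cases m with
  | zero =>
    rw [← star_star (h.rhoMN 0 n g), ← star_mul, star_rhoMN]
    refine h.closure_E_le_B (m := 0) (n := n + 1) (by push_cast at hk ⊢; omega) ?_
    refine map_mem_closure continuous_star (h.rhoMN_mul_rhoE_mem f n _) ?_
    rintro _ ⟨g, rfl⟩
    exact ⟨_, (h.star_rhoMN g).symm⟩
  | succ m =>
    refine h.rhoMN_succ_mem (V := (h.B k).comap (LinearMap.mulLeft ℂ (star (h.rhoE f))))
      ((h.isClosed_B k).preimage (continuous_const_mul _)) (fun f' g' => ?_) g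
    obtain ⟨a, ha⟩ := h.star_rhoE_mul_rhoE f f'
    rw [Submodule.mem_comap, LinearMap.mulLeft_apply, ← mul_assoc, ha, rhoA_mul_rhoMN]
    exact h.rhoMN_mem_B (by push_cast at hk; omega) _

/-- The closed direct sum of the subspaces `B_k ⊗ υ_k`. -/
def BHat (h : Admissible γ S) : Submodule ℂ (HatMat S) :=
  (⨆ k : ℤ, (h.B k).map (tensorShift S k)).topologicalClosure

theorem tensorShift_mul_mem_BHat (h : Admissible γ S) {j : ℤ} {a : Mat S}
    (ha : ∀ k, ∀ b ∈ h.B k, a * b ∈ h.B (j + k)) {w : HatMat S} (hw : w ∈ h.BHat) :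
    tensorShift S j a * w ∈ h.BHat := by
  have : h.BHat ≤ h.BHat.comap (LinearMap.mulLeft ℂ (tensorShift S j a)) := by
    refine Submodule.topologicalClosure_minimal _ (iSup_le fun k => ?_)
      ((Submodule.isClosed_topologicalClosure _).preimage (continuous_const_mul _))
    rintro _ ⟨b, hb, rfl⟩
    rw [Submodule.mem_comap, LinearMap.mulLeft_apply, tensorShift_mul]
    exact Submodule.le_topologicalClosure _ (Submodule.mem_iSup_of_mem (j + k) ⟨_, ha k b hb, rfl⟩)
  exact this hw

theorem cstarHat_le_BHat (h : Admissible γ S) {b : HatMat S} (hb : b ∈ h.cstarHat) :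
    b ∈ h.BHat := by
  -- It is enough that the generated algebra acts on `BHat` by left multiplication; then `b = b * 1`
  -- lies in `BHat`. Carrying `star b` along makes the induction stable under adjoints.
  have halg : ∀ b ∈ NonUnitalStarAlgebra.adjoin ℂ (Set.range h.rhoHatA ∪ Set.range h.rhoHatE),
      (∀ w ∈ h.BHat, b * w ∈ h.BHat) ∧ ∀ w ∈ h.BHat, star b * w ∈ h.BHat := by
    intro b hb
    induction hb using NonUnitalStarAlgebra.adjoin_induction with
    | mem b hb =>
      rcases hb with ⟨a, rfl⟩ | ⟨f, rfl⟩
      · refine ⟨fun w hw => h.tensorShift_mul_mem_BHat (fun k b hb => ?_) hw, fun w hw => ?_⟩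
        · rw [zero_add]; exact h.rhoA_mul_mem_B a hb
        · rw [rhoHatA, star_tensorShift, star_rhoA]
          refine h.tensorShift_mul_mem_BHat (fun k b hb => ?_) hw
          rw [neg_zero, zero_add]; exact h.rhoA_mul_mem_B _ hb
      · refine ⟨fun w hw => h.tensorShift_mul_mem_BHat (fun k b hb => h.rhoE_mul_mem_B f hb) hw,
          fun w hw => ?_⟩
        rw [rhoHatE, star_tensorShift]
        refine h.tensorShift_mul_mem_BHat (fun k b hb => ?_) hw
        exact h.mul_mem_B (fun m n hk g => h.star_rhoE_mul_rhoMN_mem f (by omega) g) hb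
    | add a b _ _ ha hb =>
      refine ⟨fun w hw => ?_, fun w hw => ?_⟩
      · rw [add_mul]; exact add_mem (ha.1 w hw) (hb.1 w hw)
      · rw [star_add, add_mul]; exact add_mem (ha.2 w hw) (hb.2 w hw)
    | zero => simp
    | mul a b _ _ ha hb =>
      refine ⟨fun w hw => ?_, fun w hw => ?_⟩
      · rw [mul_assoc]; exact ha.1 _ (hb.1 w hw)
      · rw [star_mul, mul_assoc]; exact hb.2 _ (ha.2 w hw)
    | smul c a _ ha =>
      refine ⟨fun w hw => ?_, fun w hw => ?_⟩
      · rw [smul_mul_assoc]; exact Submodule.smul_mem _ _ (ha.1 w hw)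
      · rw [star_smul, smul_mul_assoc]; exact Submodule.smul_mem _ _ (ha.2 w hw)
    | star a _ ha => exact ⟨ha.2, by rw [star_star]; exact ha.1⟩
  have hone : (1 : HatMat S) ∈ h.BHat := by
    refine Submodule.le_topologicalClosure _ (Submodule.mem_iSup_of_mem 0 ⟨1, ?_, tensorShift_zero_one⟩)
    rw [← h.rhoA_one, ← rhoMN_zero_zero]
    exact h.rhoMN_mem_B (by simp) _
  refine closure_minimal (t := (h.BHat : Set (HatMat S))) (fun b hb => ?_)
    (Submodule.isClosed_topologicalClosure _) hb
  simpa using (halg b hb).1 1 hone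

theorem rhoHatA_mem (h : Admissible γ S) (a : C(X, ℂ)) : h.rhoHatA a ∈ h.cstarHat :=
  NonUnitalStarSubalgebra.le_topologicalClosure _
    (NonUnitalStarAlgebra.subset_adjoin ℂ _ (Or.inl ⟨a, rfl⟩))

theorem rhoHatE_mem (h : Admissible γ S) (f : C(Graph γ, ℂ)) : h.rhoHatE f ∈ h.cstarHat :=
  NonUnitalStarSubalgebra.le_topologicalClosure _
    (NonUnitalStarAlgebra.subset_adjoin ℂ _ (Or.inr ⟨f, rfl⟩))

theorem isClosed_cstarHat (h : Admissible γ S) : IsClosed (h.cstarHat : Set (HatMat S)) :=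
  NonUnitalStarSubalgebra.isClosed_topologicalClosure _

theorem tensorShift_rhoMN_mem (h : Admissible γ S) (m n : ℕ) (f : C(Bichain γ m n, ℂ)) :
    tensorShift S (m - n) (h.rhoMN m n f) ∈ h.cstarHat := by
  have hstep : ∀ m n, (∀ f : C(Bichain γ m n, ℂ),
      tensorShift S (m - n) (h.rhoMN m n f) ∈ h.cstarHat) → ∀ f : C(Bichain γ (m + 1) n, ℂ),
      tensorShift S ((m + 1 : ℕ) - n) (h.rhoMN (m + 1) n f) ∈ h.cstarHat := by
    intro m n ih f
    refine h.rhoMN_succ_mem (V := (h.cstarHat.toSubmodule).comap (tensorShift S ((m + 1 : ℕ) - n)))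
      (h.isClosed_cstarHat.preimage (continuous_tensorShift _)) (fun f g => ?_) f
    rw [Submodule.mem_comap,
      show (((m + 1 : ℕ) : ℤ) - n) = 1 + ((m : ℤ) - n) by push_cast; ring, ← tensorShift_mul]
    exact h.cstarHat.mul_mem (h.rhoHatE_mem f) (ih g)
  have h0 : ∀ m, ∀ f : C(Bichain γ m 0, ℂ),
      tensorShift S (m - (0 : ℕ)) (h.rhoMN m 0 f) ∈ h.cstarHat := by
    intro m
    induction m with
    | zero => intro f; rw [rhoMN_zero_zero_eq]; exact h.rhoHatA_mem _
    | succ m ih => exact hstep m 0 ih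
  induction m with
  -- Left length `0` is reached from right length `0` by taking adjoints.
  | zero =>
    have := star_mem (h0 n (star f |>.comp (bichainSwap γ n 0)))
    rw [star_tensorShift, ← star_rhoMN, star_star] at this
    simpa using this
  | succ m ih => exact hstep m n ih f

theorem tensorShift_B_mem (h : Admissible γ S) {k : ℤ} {b : Mat S} (hb : b ∈ h.B k) :
    tensorShift S k b ∈ h.cstarHat := by
  refine h.B_le (V := (h.cstarHat.toSubmodule).comap (tensorShift S k))
    (h.isClosed_cstarHat.preimage (continuous_tensorShift _)) (fun m n hk f => ?_) hb
  subst hk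
  exact h.tensorShift_rhoMN_mem m n f

theorem coeff_mem_B (h : Admissible γ S) {b : HatMat S} (hb : b ∈ h.BHat) (k : ℤ) :
    coeff S k b ∈ h.B k := by
  have : h.BHat ≤ (h.B k).comap (coeff S k).toLinearMap := by
    refine Submodule.topologicalClosure_minimal _ (iSup_le fun j => ?_)
      ((h.isClosed_B k).preimage (coeff S k).continuous)
    rintro _ ⟨b, hb, rfl⟩
    rw [Submodule.mem_comap, ContinuousLinearMap.coe_coe, coeff_tensorShift]
    split_ifs with hjk
    · exact hjk ▸ hb
    · exact zero_mem _
  exact this hb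

/-! ### The masa -/

/-- Commutation says `a x * b_{xy} = a y * b_{xy}` for all `a`, and continuous functions separate
the points of `X`. -/
theorem mem_diagMat_iff_commute (h : Admissible γ S) (b : Mat S) :
    b ∈ diagMat S ↔ ∀ a, h.rhoA a * b = b * h.rhoA a := by
  have hl : ∀ a (x y : S), ⟪basisVec x, (h.rhoA a * b) (basisVec y)⟫_ℂ =
      a x * ⟪basisVec x, b (basisVec y)⟫_ℂ := by
    intro a x y
    rw [ContinuousLinearMap.mul_def, ContinuousLinearMap.comp_apply, inner_basisVec_left,
      inner_basisVec_left, rhoA, diagOp_apply]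
  have hr : ∀ a (x y : S), ⟪basisVec x, (b * h.rhoA a) (basisVec y)⟫_ℂ =
      a y * ⟪basisVec x, b (basisVec y)⟫_ℂ := by
    intro a x y
    rw [ContinuousLinearMap.mul_def, ContinuousLinearMap.comp_apply, rhoA_basisVec, map_smul,
      inner_smul_right]
  constructor
  · refine fun hb a => Mat.ext_inner fun x y => ?_
    rw [hl, hr]
    by_cases h0 : ⟪basisVec x, b (basisVec y)⟫_ℂ = 0
    · rw [h0, mul_zero, mul_zero]
    · rw [hb x y h0]
  · intro hcomm x y hne
    by_contra hxy
    obtain ⟨a, ha⟩ := exists_continuous_apply_ne fun he : (x : X) = y => hxy (Subtype.ext he)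
    have := hl a x y
    rw [hcomm a, hr] at this
    exact ha (mul_right_cancel₀ hne this).symm

theorem diagMat_mul_comm {Y : Type*} {a b : Mat Y} (ha : a ∈ diagMat Y) (hb : b ∈ diagMat Y) :
    a * b = b * a := by
  have key : ∀ {a : Mat Y}, a ∈ diagMat Y → ∀ y, ∃ c : ℂ, a (basisVec y) = c • basisVec y := by
    classical
    intro a ha y
    refine ⟨⟪basisVec y, a (basisVec y)⟫_ℂ, ?_⟩
    ext x
    rw [lp.coeFn_smul, Pi.smul_apply, basisVec_apply, inner_basisVec_left]
    split_ifs with hxy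
    · rw [hxy]; simp
    · rw [smul_zero, ← inner_basisVec_left]
      by_contra hne
      exact hxy (ha x y hne)
  refine Mat.ext_basisVec fun y => ?_
  obtain ⟨c, hc⟩ := key ha y
  obtain ⟨d, hd⟩ := key hb y
  rw [ContinuousLinearMap.mul_def, ContinuousLinearMap.mul_def, ContinuousLinearMap.comp_apply,
    ContinuousLinearMap.comp_apply, hd, hc, map_smul, map_smul, hd, hc, smul_comm]

theorem isClosed_diagMat (h : Admissible γ S) : IsClosed (diagMat S : Set (Mat S)) := by
  have : (diagMat S : Set (Mat S)) = ⋂ a, {b | h.rhoA a * b = b * h.rhoA a} := by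
    ext b
    simp [h.mem_diagMat_iff_commute]
  rw [this]
  exact isClosed_iInter fun a => isClosed_eq (continuous_const_mul _) (continuous_mul_const _)

theorem isClosed_D (h : Admissible γ S) (k : ℤ) : IsClosed (h.D k : Set (Mat S)) :=
  (h.isClosed_B k).inter h.isClosed_diagMat

theorem isClosed_DHat (h : Admissible γ S) : IsClosed (h.DHat : Set (HatMat S)) :=
  Submodule.isClosed_topologicalClosure _

theorem tensorShift_mem_DHat (h : Admissible γ S) {k : ℤ} {b : Mat S} (hb : b ∈ h.D k) :
    tensorShift S k b ∈ h.DHat :=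
  Submodule.le_topologicalClosure _ (Submodule.mem_iSup_of_mem k ⟨b, hb, rfl⟩)

theorem DHat_le (h : Admissible γ S) {V : Submodule ℂ (HatMat S)}
    (hV : IsClosed (V : Set (HatMat S)))
    (hmem : ∀ k, ∀ b ∈ h.D k, tensorShift S k b ∈ V) : h.DHat ≤ V := by
  refine Submodule.topologicalClosure_minimal _ (iSup_le fun k => ?_) hV
  rintro _ ⟨b, hb, rfl⟩
  exact hmem k b hb

/-- Diagonal matrices commute and so do the shifts; closedness of the commutation relation extends
this to the closed span, one factor at a time. -/
theorem DHat_mul_comm (h : Admissible γ S) {a b : HatMat S} (ha : a ∈ h.DHat) (hb : b ∈ h.DHat) :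
    a * b = b * a := by
  have h1 : ∀ j, ∀ a ∈ h.D j, ∀ b ∈ h.DHat, tensorShift S j a * b = b * tensorShift S j a := by
    intro j a ha b hb
    refine h.DHat_le (V := LinearMap.eqLocus (LinearMap.mulLeft ℂ (tensorShift S j a))
      (LinearMap.mulRight ℂ (tensorShift S j a))) (isClosed_eq (continuous_const_mul _)
      (continuous_mul_const _)) (fun k b hb => ?_) hb
    rw [LinearMap.mem_eqLocus, LinearMap.mulLeft_apply, LinearMap.mulRight_apply, tensorShift_mul,
      tensorShift_mul, diagMat_mul_comm ha.2 hb.2, add_comm]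
  refine h.DHat_le (V := LinearMap.eqLocus (LinearMap.mulRight ℂ b) (LinearMap.mulLeft ℂ b))
    (isClosed_eq (continuous_mul_const _) (continuous_const_mul _))
    (fun k a ha => h1 k a ha b hb) ha

theorem rhoA_mem_D (h : Admissible γ S) (a : C(X, ℂ)) : h.rhoA a ∈ h.D 0 := by
  refine ⟨?_, (h.mem_diagMat_iff_commute _).2 fun b => ?_⟩
  · rw [← rhoMN_zero_zero]
    exact h.rhoMN_mem_B (by simp) _
  · refine Mat.ext_basisVec fun y => ?_
    rw [ContinuousLinearMap.mul_def, ContinuousLinearMap.mul_def, ContinuousLinearMap.comp_apply,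
      ContinuousLinearMap.comp_apply, rhoA_basisVec, rhoA_basisVec, map_smul, map_smul,
      rhoA_basisVec, rhoA_basisVec, smul_comm]

theorem rhoHatA_mem_DHat (h : Admissible γ S) (a : C(X, ℂ)) : h.rhoHatA a ∈ h.DHat :=
  h.tensorShift_mem_DHat (h.rhoA_mem_D a)

/-- `D̂` is the relative commutant of `ρ̂_A(A)`. -/
theorem mem_DHat_iff (h : Admissible γ S) (b : HatMat S) :
    b ∈ h.DHat ↔ b ∈ h.cstarHat ∧ ∀ a, h.rhoHatA a * b = b * h.rhoHatA a := by
  constructor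
  · refine fun hb => ⟨?_, fun a => h.DHat_mul_comm (h.rhoHatA_mem_DHat a) hb⟩
    exact h.DHat_le (V := h.cstarHat.toSubmodule) h.isClosed_cstarHat
      (fun k b hb => h.tensorShift_B_mem hb.1) hb
  · rintro ⟨hb, hcomm⟩
    -- Each coefficient of `b` lies in `B_k` and commutes with `ρ_A(A)`, hence lies in `D_k`.
    refine mem_of_tensorShift_coeff_mem h.B h.DHat h.isClosed_DHat (h.cstarHat_le_BHat hb)
      fun k => h.tensorShift_mem_DHat ⟨h.coeff_mem_B (h.cstarHat_le_BHat hb) k, ?_⟩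
    refine (h.mem_diagMat_iff_commute _).2 fun a => ?_
    rw [← coeff_tensorShift_zero_mul, ← coeff_mul_tensorShift_zero]
    exact congrArg _ (hcomm a)

/-- `D̂` as a star subalgebra. -/
def DHatAlg (h : Admissible γ S) : NonUnitalStarSubalgebra ℂ (HatMat S) where
  carrier := h.DHat
  add_mem' := fun ha hb => add_mem ha hb
  zero_mem' := zero_mem _
  smul_mem' := fun c _ ha => Submodule.smul_mem _ c ha
  mul_mem' := by
    intro a b ha hb
    -- Products are handled through the commutant description, where closure is immediate.
    rw [SetLike.mem_coe, mem_DHat_iff] at *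
    refine ⟨mul_mem ha.1 hb.1, fun c => ?_⟩
    rw [← mul_assoc, ha.2, mul_assoc, hb.2, mul_assoc]
  star_mem' := by
    intro a ha
    change star a ∈ h.DHat
    rw [SetLike.mem_coe, mem_DHat_iff] at *
    refine ⟨star_mem ha.1, fun c => ?_⟩
    have := congrArg star (ha.2 (star c))
    have hs : star (h.rhoHatA (star c)) = h.rhoHatA c := by
      rw [rhoHatA, star_tensorShift, star_rhoA, star_star, neg_zero]; rfl
    rw [star_mul, star_mul, hs] at this
    exact this.symm

/-- A commutative subalgebra containing `D̂` commutes with `ρ̂_A(A)`, hence lies in the relative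
commutant `D̂`. -/
theorem isMasa_DHat (h : Admissible γ S) : IsMasa h.cstarHat (h.DHat : Set (HatMat S)) := by
  refine ⟨h.DHatAlg, rfl, ⟨fun b hb => ((h.mem_DHat_iff b).1 hb).1, h.isClosed_DHat,
    fun a ha b hb => h.DHat_mul_comm ha hb⟩, ?_⟩
  rintro F ⟨hF1, -, hF2⟩ hle b hb
  exact (h.mem_DHat_iff b).2 ⟨hF1 hb, fun a => hF2 _ (hle (h.rhoHatA_mem_DHat a)) _ hb⟩

end Admissible

namespace Admissible

/-! ### Words -/

section Words

variable {X : Type*} [TopologicalSpace X] {N : ℕ} {γ : Fin N → C(X, X)} {S : Set X}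

/-- The composition of the maps `γ_k` along a list, the head of the list being applied last. -/
def wordS (h : Admissible γ S) (l : List (Fin N)) (x : S) : S := l.foldr h.gamS x

theorem wordS_append (h : Admissible γ S) (l l' : List (Fin N)) (x : S) :
    h.wordS (l ++ l') x = h.wordS l (h.wordS l' x) := List.foldr_append

theorem compS_eq_wordS (h : Admissible γ S) {n : ℕ} (k : Fin n → Fin N) (x : S) :
    h.compS k x = h.wordS (List.ofFn k).reverse x := by
  induction n with
  | zero => simp [wordS, compS_zero]
  | succ n ih =>
    rw [compS_succ, ih, List.ofFn_succ_last, List.reverse_append]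
    rfl

theorem wordS_eq (h : Admissible γ S) {l l' : List (Fin N)} (hl : l.length = l'.length) {x y : S}
    (hxy : h.wordS l x = h.wordS l' y) : l = l' ∧ x = y := by
  induction l generalizing l' with
  | nil =>
    obtain rfl : l' = [] := List.length_eq_zero_iff.1 hl.symm
    exact ⟨rfl, hxy⟩
  | cons i l ih =>
    cases l' with
    | nil => simp at hl
    | cons i' l' =>
      obtain ⟨rfl, h2⟩ := h.gamS_eq hxy
      obtain ⟨rfl, rfl⟩ := ih (by simpa using hl) h2
      exact ⟨rfl, rfl⟩

theorem continuous_gamS (h : Admissible γ S) (i : Fin N) : Continuous (h.gamS i) :=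
  Continuous.subtype_mk ((γ i).continuous.comp continuous_subtype_val) _

theorem continuous_wordS (h : Admissible γ S) (l : List (Fin N)) : Continuous (h.wordS l) := by
  induction l with
  | nil => exact continuous_id
  | cons i l ih => exact (h.continuous_gamS i).comp ih

theorem isEmbedding_gamS (h : Admissible γ S) (hemb : ∀ k, Topology.IsEmbedding (γ k)) (i : Fin N) :
    Topology.IsEmbedding (h.gamS i) :=
  Topology.IsEmbedding.of_comp (h.continuous_gamS i) continuous_subtype_val
    ((hemb i).comp Topology.IsEmbedding.subtypeVal)

/-- By complete invariance the range is the trace on `S` of the open set `γ_i(U)`. It is also the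
trace of the compact set `γ_i(X)`, so it is clopen in `S`, which `continuous_kernel` uses. -/
theorem isOpenEmbedding_gamS (h : Admissible γ S) (hemb : ∀ k, Topology.IsEmbedding (γ k))
    {U : Set X} (hUimo : ∀ k, IsOpen (γ k '' U)) (hSU : S ⊆ U) (i : Fin N) :
    Topology.IsOpenEmbedding (h.gamS i) := by
  refine ⟨h.isEmbedding_gamS hemb i, ?_⟩
  have : Set.range (h.gamS i) = Subtype.val ⁻¹' (γ i '' U) := by
    ext x
    constructor
    · rintro ⟨y, rfl⟩
      exact ⟨y, hSU y.2, rfl⟩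
    · rintro ⟨u, -, hu⟩
      exact ⟨⟨u, h.preimage_subset i (by rw [Set.mem_preimage, hu]; exact x.2)⟩, Subtype.ext hu⟩
  rw [this]
  exact (hUimo i).preimage continuous_subtype_val

theorem isClosedEmbedding_gamS [CompactSpace X] [T2Space X] (h : Admissible γ S)
    (hemb : ∀ k, Topology.IsEmbedding (γ k)) (i : Fin N) :
    Topology.IsClosedEmbedding (h.gamS i) := by
  refine ⟨h.isEmbedding_gamS hemb i, ?_⟩
  have : Set.range (h.gamS i) = Subtype.val ⁻¹' (Set.range (γ i)) := by
    ext x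
    constructor
    · rintro ⟨y, rfl⟩
      exact ⟨y, rfl⟩
    · rintro ⟨u, hu⟩
      exact ⟨⟨u, h.preimage_subset i (by rw [Set.mem_preimage, hu]; exact x.2)⟩, Subtype.ext hu⟩
  rw [this]
  exact (isCompact_range (γ i).continuous).isClosed.preimage continuous_subtype_val

theorem isOpenEmbedding_wordS (h : Admissible γ S) (hemb : ∀ k, Topology.IsEmbedding (γ k))
    {U : Set X} (hUimo : ∀ k, IsOpen (γ k '' U)) (hSU : S ⊆ U) (l : List (Fin N)) :
    Topology.IsOpenEmbedding (h.wordS l) := by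
  induction l with
  | nil => exact Topology.IsOpenEmbedding.id
  | cons i l ih => exact (h.isOpenEmbedding_gamS hemb hUimo hSU i).comp ih

theorem isClosedEmbedding_wordS [CompactSpace X] [T2Space X] (h : Admissible γ S)
    (hemb : ∀ k, Topology.IsEmbedding (γ k)) (l : List (Fin N)) :
    Topology.IsClosedEmbedding (h.wordS l) := by
  induction l with
  | nil => exact Topology.IsClosedEmbedding.id
  | cons i l ih => exact (h.isClosedEmbedding_gamS hemb i).comp ih

/-- Continuity along a pair of words of a kernel supported on the pairs `(γ_{j'} w, γ_{k'} w)`. -/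
theorem continuous_kernel [CompactSpace X] [T2Space X] (h : Admissible γ S)
    (hemb : ∀ k, Topology.IsEmbedding (γ k))
    {U : Set X} (hUimo : ∀ k, IsOpen (γ k '' U)) (hSU : S ⊆ U) {j' k' j p : List (Fin N)}
    (hlen : j'.length + p.length = j.length + k'.length) (F : S → S → ℂ) {a : S → ℂ}
    (ha : Continuous a) (hF : ∀ w, F (h.wordS j' w) (h.wordS k' w) = a w)
    (hF0 : ∀ x y, (∀ w, x = h.wordS j' w → y ≠ h.wordS k' w) → F x y = 0) :
    Continuous fun z => F (h.wordS j z) (h.wordS p z) := by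
  rcases le_total k'.length p.length with hle | hle
  · obtain ⟨p1, p2, rfl, hp1⟩ : ∃ p1 p2, p = p1 ++ p2 ∧ p1.length = k'.length :=
      ⟨p.take k'.length, p.drop k'.length, (List.take_append_drop _ _).symm, by simp [hle]⟩
    obtain ⟨j1, j2, rfl, hj1⟩ : ∃ j1 j2, j = j1 ++ j2 ∧ j1.length = j'.length :=
      ⟨j.take j'.length, j.drop j'.length, (List.take_append_drop _ _).symm, by simp; omega⟩
    simp only [List.length_append] at hlen
    -- The given words are longer than the supporting ones. A nonzero value forces `w` to be the
    -- image of `z` under both `j2` and `p2`, words of equal length, so they coincide; otherwise the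
    -- function is zero.
    by_cases hc : j1 = j' ∧ p1 = k' ∧ j2 = p2
    · obtain ⟨rfl, rfl, rfl⟩ := hc
      simp only [wordS_append, hF]
      exact ha.comp (h.continuous_wordS _)
    · have : (fun z => F (h.wordS (j1 ++ j2) z) (h.wordS (p1 ++ p2) z)) = fun _ => 0 := by
        ext z
        refine hF0 _ _ fun w hx hy => hc ?_
        rw [wordS_append] at hx hy
        obtain ⟨rfl, rfl⟩ := h.wordS_eq hj1 hx
        obtain ⟨rfl, h2⟩ := h.wordS_eq hp1 hy
        exact ⟨rfl, rfl, (h.wordS_eq (by omega) h2).1.symm⟩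
      rw [this]
      exact continuous_const
  · obtain ⟨k1, k2, rfl, hk1⟩ : ∃ k1 k2, k' = k1 ++ k2 ∧ k1.length = p.length :=
      ⟨k'.take p.length, k'.drop p.length, (List.take_append_drop _ _).symm, by simp [hle]⟩
    obtain ⟨j1, j2, rfl, hj1⟩ : ∃ j1 j2, j' = j1 ++ j2 ∧ j1.length = j.length :=
      ⟨j'.take j.length, j'.drop j.length, (List.take_append_drop _ _).symm, by simp; omega⟩
    simp only [List.length_append] at hlen
    simp only [wordS_append] at hF hF0
    by_cases hc : j1 = j ∧ k1 = p ∧ j2 = k2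
    · obtain ⟨rfl, rfl, rfl⟩ := hc
      rw [continuous_iff_continuousAt]
      intro z
      -- Now the supporting words are longer. The function is `a w` at the image of `w` under `j2`
      -- and `0` off that range; since the range is clopen, the pieces fit together continuously.
      by_cases hz : z ∈ Set.range (h.wordS j2)
      · obtain ⟨v, rfl⟩ := hz
        rw [← (h.isOpenEmbedding_wordS hemb hUimo hSU j2).continuousAt_iff]
        simp only [Function.comp_def, hF]
        exact ha.continuousAt
      · have ho : (Set.range (h.wordS j2))ᶜ ∈ nhds z :=
          (h.isClosedEmbedding_wordS hemb j2).isClosed_range.isOpen_compl.mem_nhds hz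
        refine (continuousAt_const (y := (0 : ℂ))).congr ?_
        filter_upwards [ho] with y hy
        refine (hF0 _ _ fun w hx _ => hy ⟨w, ?_⟩).symm
        exact (h.wordS_eq rfl hx).2.symm
    · have : (fun z => F (h.wordS j z) (h.wordS p z)) = fun _ => 0 := by
        ext z
        refine hF0 _ _ fun w hx hy => hc ?_
        obtain ⟨rfl, rfl⟩ := h.wordS_eq hj1.symm hx
        obtain ⟨rfl, h2⟩ := h.wordS_eq hk1.symm hy
        exact ⟨rfl, rfl, (h.wordS_eq (by omega) h2).1⟩
      rw [this]
      exact continuous_const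

end Words

section Branches

variable {X : Type*} [TopologicalSpace X] {N : ℕ} {γ : Fin N → C(X, X)} {U : Set X}

theorem continuous_comp (γ : Fin N → C(X, X)) {n : ℕ} (k : Fin n → Fin N) :
    Continuous (comp γ k) :=
  (continuous_apply _).comp (continuous_path γ k)

/-! ### Branches of the space of bichains -/

/-- The bichains all of whose points after the first lie on the branches given by two index
sequences. -/
def branch (γ : Fin N → C(X, X)) (U : Set X) {m n : ℕ} (j : Fin m → Fin N) (k : Fin n → Fin N) :
    Set (Bichain γ m n) :=
  {z | (∀ i, z.1.1 i.succ ∈ γ (j i) '' U) ∧ ∀ i, z.1.2 i.succ ∈ γ (k i) '' U}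

theorem isOpen_branch (hUimo : ∀ k, IsOpen (γ k '' U)) {m n : ℕ} (j : Fin m → Fin N)
    (k : Fin n → Fin N) : IsOpen (branch γ U j k) := by
  have : branch γ U j k = (⋂ i, (fun z : Bichain γ m n => z.1.1 i.succ) ⁻¹' (γ (j i) '' U)) ∩
      ⋂ i, (fun z : Bichain γ m n => z.1.2 i.succ) ⁻¹' (γ (k i) '' U) := by
    ext z
    simp [branch]
  rw [this]
  exact (isOpen_iInter_of_finite fun i => (hUimo (j i)).preimage (by fun_prop)).inter
    (isOpen_iInter_of_finite fun i => (hUimo (k i)).preimage (by fun_prop))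

theorem eq_of_mem_branch (hUdisj : Pairwise fun j k => Disjoint (γ j '' U) (γ k '' U)) {m n : ℕ}
    {j j' : Fin m → Fin N} {k k' : Fin n → Fin N} {z : Bichain γ m n} (hz : z ∈ branch γ U j k)
    (hz' : z ∈ branch γ U j' k') : j = j' ∧ k = k' := by
  constructor
  · ext1 i
    by_contra hne
    exact (hUdisj hne).ne_of_mem (hz.1 i) (hz'.1 i) rfl
  · ext1 i
    by_contra hne
    exact (hUdisj hne).ne_of_mem (hz.2 i) (hz'.2 i) rfl

theorem chain_mem (hUsub : ∀ k, γ k '' U ⊆ U) {n : ℕ} {x : Fin (n + 1) → X} (hx : IsChain γ x)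
    (h0 : x 0 ∈ U) (i : Fin (n + 1)) : x i ∈ U := by
  induction i using Fin.induction with
  | zero => exact h0
  | succ i ih =>
    obtain ⟨k, hk⟩ := hx i
    rw [hk]
    exact hUsub k ⟨_, ih, rfl⟩

/-- Over starting points in `U` the branches are thus finitely many disjoint open sets that cover,
so the indicator of one branch is locally constant there. -/
theorem exists_mem_branch (hUsub : ∀ k, γ k '' U ⊆ U) {m n : ℕ} {z : Bichain γ m n}
    (hz : z.1.1 0 ∈ U) : ∃ j k, z ∈ branch γ U j k := by
  choose j hj using z.2.1
  choose k hk using z.2.2.1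
  refine ⟨j, k, fun i => ⟨_, chain_mem hUsub z.2.1 hz _, (hj i).symm⟩,
    fun i => ⟨_, chain_mem hUsub z.2.2.1 (z.2.2.2 ▸ hz) _, (hk i).symm⟩⟩

theorem bichainAt_mem_branch (hUsub : ∀ k, γ k '' U ⊆ U) {m n : ℕ} (j : Fin m → Fin N)
    (k : Fin n → Fin N) {x : X} (hx : x ∈ U) : bichainAt γ j k x ∈ branch γ U j k :=
  ⟨fun i => ⟨_, chain_mem hUsub (bichainAt γ j k x).2.1 hx i.castSucc, (path_succ γ j x i).symm⟩,
    fun i => ⟨_, chain_mem hUsub (bichainAt γ j k x).2.2.1 hx i.castSucc, (path_succ γ k x i).symm⟩⟩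

/-- A continuous function on `X` that vanishes outside `U` lifts to a continuous function on the
space of bichains that is supported on a single branch. -/
theorem exists_bump (hUdisj : Pairwise fun j k => Disjoint (γ j '' U) (γ k '' U))
    (hUimo : ∀ k, IsOpen (γ k '' U)) (hUsub : ∀ k, γ k '' U ⊆ U) {m n : ℕ} (j : Fin m → Fin N)
    (k : Fin n → Fin N) (a : C(X, ℂ)) (ha : ∀ x ∉ U, a x = 0) :
    ∃ f : C(Bichain γ m n, ℂ), (∀ x ∈ U, f (bichainAt γ j k x) = a x) ∧
      ∀ j' k', ∀ x ∈ U, ¬ (j' = j ∧ k' = k) → f (bichainAt γ j' k' x) = 0 := by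
  classical
  have hca : Continuous fun z : Bichain γ m n => a (z.1.1 0) := by fun_prop
  have hc : Continuous fun z : Bichain γ m n => if z ∈ branch γ U j k then a (z.1.1 0) else 0 := by
    rw [continuous_iff_continuousAt]
    intro z
    by_cases hz : z.1.1 0 ∈ U
    · obtain ⟨j', k', hz'⟩ := exists_mem_branch hUsub hz
      have hnhds := (isOpen_branch hUimo j' k').mem_nhds hz'
      by_cases hjk : j' = j ∧ k' = k
      · obtain ⟨rfl, rfl⟩ := hjk
        refine hca.continuousAt.congr ?_
        filter_upwards [hnhds] with y hy
        rw [if_pos hy]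
      · refine (continuousAt_const (y := (0 : ℂ))).congr ?_
        filter_upwards [hnhds] with y hy
        rw [if_neg fun hy' => hjk (eq_of_mem_branch hUdisj hy hy')]
    -- Over a starting point outside `U` the branches may meet, but the function is bounded by `‖a‖`
    -- at the starting point, which tends to `0`.
    · have h0 : (if z ∈ branch γ U j k then a (z.1.1 0) else 0) = 0 := by
        rw [ha _ hz, ite_self]
      have h1 := hca.continuousAt (x := z)
      rw [ContinuousAt, ha _ hz] at h1
      rw [ContinuousAt, h0]
      refine squeeze_zero_norm (fun y => ?_) (tendsto_norm_zero.comp h1)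
      simp only [Function.comp]
      split_ifs
      · exact le_rfl
      · rw [norm_zero]; exact norm_nonneg _
  refine ⟨⟨_, hc⟩, fun x hx => ?_, fun j' k' x hx hne => ?_⟩
  · exact if_pos (bichainAt_mem_branch hUsub j k hx)
  · exact if_neg fun hmem =>
      hne (eq_of_mem_branch hUdisj (bichainAt_mem_branch hUsub j' k' hx) hmem)

end Branches

/-! ### Diagonal elements of nonzero degree and essential freeness -/

variable {X : Type*} [TopologicalSpace X] [CompactSpace X] [T2Space X] {N : ℕ}
  {γ : Fin N → C(X, X)} {S U : Set X}

theorem inner_term_of_eq (h : Admissible γ S) {m n : ℕ} (f : C(Bichain γ m n, ℂ))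
    (j : Fin m → Fin N) (k : Fin n → Fin N) (x w : S) :
    ⟪basisVec x, (h.compOp j ∘L h.coeffOp f j k ∘L ContinuousLinearMap.adjoint (h.compOp k))
      (basisVec (h.compS k w))⟫_ℂ =
        f (bichainAt γ j k w) * ⟪(basisVec x : Hil S), basisVec (h.compS j w)⟫_ℂ := by
  classical
  have hadj : ContinuousLinearMap.adjoint (h.compOp k) (basisVec (h.compS k w)) = basisVec w := by
    ext z
    rw [adjoint_compOp_basisVec, inner_basisVec_basisVec, basisVec_apply]
    simp only [(h.compS_injective k).eq_iff]
  rw [ContinuousLinearMap.comp_apply, ContinuousLinearMap.comp_apply, hadj, coeffOp,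
    diagOp_basisVec, map_smul, inner_smul_right, compOp, LinearIsometry.coe_toContinuousLinearMap,
    pushIso_basisVec]

theorem inner_term_eq_zero (h : Admissible γ S) {m n : ℕ} (f : C(Bichain γ m n, ℂ))
    (j : Fin m → Fin N) (k : Fin n → Fin N) (x y : S)
    (hxy : ∀ w, x = h.compS j w → y ≠ h.compS k w) :
    ⟪basisVec x, (h.compOp j ∘L h.coeffOp f j k ∘L ContinuousLinearMap.adjoint (h.compOp k))
      (basisVec y)⟫_ℂ = 0 := by
  classical
  by_cases hy : ∃ w, y = h.compS k w
  · obtain ⟨w, rfl⟩ := hy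
    rw [inner_term_of_eq, inner_basisVec_basisVec, if_neg fun hx => hxy w hx rfl, mul_zero]
  · have hadj : ContinuousLinearMap.adjoint (h.compOp k) (basisVec y) = 0 := by
      ext z
      rw [adjoint_compOp_basisVec, inner_basisVec_basisVec, if_neg fun he => hy ⟨z, he.symm⟩]
      rfl
    rw [ContinuousLinearMap.comp_apply, ContinuousLinearMap.comp_apply, hadj, map_zero, map_zero,
      inner_zero_right]

/-- Along words whose lengths differ by `k`, the entries of an operator in `B_k` are continuous. -/
theorem continuous_inner_of_mem_B (h : Admissible γ S) (hemb : ∀ k, Topology.IsEmbedding (γ k))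
    (hUimo : ∀ k, IsOpen (γ k '' U)) (hSU : S ⊆ U) {m n : ℕ} (j : Fin m → Fin N)
    (p : Fin n → Fin N) {b : Mat S} (hb : b ∈ h.B (m - n)) :
    Continuous fun z : S => ⟪basisVec (h.compS j z), b (basisVec (h.compS p z))⟫_ℂ := by
  let V : Submodule ℂ (Mat S) :=
    { carrier := {b | Continuous fun z : S =>
        ⟪basisVec (h.compS j z), b (basisVec (h.compS p z))⟫_ℂ}
      add_mem' := fun {a b} ha hb => by
        simp only [Set.mem_ofPred_eq, add_apply, inner_add_right] at *
        exact ha.add hb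
      zero_mem' := by
        simp only [Set.mem_ofPred_eq, zero_apply, inner_zero_right]
        exact continuous_const
      smul_mem' := fun c a ha => by
        simp only [Set.mem_ofPred_eq, smul_apply, inner_smul_right] at *
        exact continuous_const.mul ha }
  -- Matrix entries are bounded by the operator norm, so norm limits give uniform limits of the
  -- entry functions.
  have hV : IsClosed (V : Set (Mat S)) := by
    refine isClosed_of_closure_subset fun a ha => ?_
    refine continuous_of_uniform_approx_of_continuous fun u hu => ?_
    obtain ⟨ε, hε, hu⟩ := Metric.mem_uniformity_dist.1 hu
    obtain ⟨v, hv, hd⟩ := Metric.mem_closure_iff.1 ha ε hε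
    refine ⟨_, hv, fun z => hu ?_⟩
    rw [dist_eq_norm, ← inner_sub_right, ← sub_apply]
    refine lt_of_le_of_lt ?_ (dist_eq_norm a v ▸ hd)
    calc _ ≤ ‖(basisVec (h.compS j z) : Hil S)‖ * ‖(a - v) (basisVec (h.compS p z))‖ :=
          norm_inner_le_norm _ _
      _ ≤ 1 * (‖a - v‖ * ‖(basisVec (h.compS p z) : Hil S)‖) := by
          rw [norm_basisVec]
          exact mul_le_mul_of_nonneg_left ((a - v).le_opNorm _) zero_le_one
      _ = ‖a - v‖ := by rw [norm_basisVec, one_mul, mul_one]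
  refine h.B_le hV (fun m' n' hk f => ?_) hb
  classical
  rw [rhoMN_apply]
  refine sum_mem fun j' _ => sum_mem fun k' _ => ?_
  change Continuous _
  simp only [compS_eq_wordS]
  refine h.continuous_kernel hemb hUimo hSU (j' := (List.ofFn j').reverse)
    (k' := (List.ofFn k').reverse) (by simp; omega) (fun x y => ⟪basisVec x, (h.compOp j' ∘L
      h.coeffOp f j' k' ∘L ContinuousLinearMap.adjoint (h.compOp k')) (basisVec y)⟫_ℂ)
    (a := fun w => f (bichainAt γ j' k' w))
    (f.continuous.comp ((continuous_bichainAt γ j' k').comp continuous_subtype_val))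
    (fun w => ?_) (fun x y hxy => ?_)
  · rw [← compS_eq_wordS, ← compS_eq_wordS, inner_term_of_eq, inner_basisVec_basisVec, if_pos rfl,
      mul_one]
  · refine h.inner_term_eq_zero f j' k' x y ?_
    simpa only [compS_eq_wordS] using hxy

/-- Without such words, the continuous functional reading the `(x, x)`-entry would kill every
generator of `B_k`. -/
theorem exists_of_inner_ne_zero (h : Admissible γ S) {k : ℤ} {b : Mat S} (hb : b ∈ h.B k) {x : S}
    (hx : ⟪basisVec x, b (basisVec x)⟫_ℂ ≠ 0) :
    ∃ (m n : ℕ) (j : Fin m → Fin N) (p : Fin n → Fin N) (z : S),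
      (m : ℤ) - n = k ∧ h.compS j z = x ∧ h.compS p z = x := by
  classical
  by_contra hno
  refine hx ?_
  let L : Mat S →L[ℂ] ℂ := innerSL ℂ (basisVec x) ∘L ContinuousLinearMap.apply ℂ _ (basisVec x)
  refine h.B_le (V := L.toLinearMap.ker) L.isClosed_ker (fun m n hk f => ?_) hb
  change ⟪basisVec x, h.rhoMN m n f (basisVec x)⟫_ℂ = 0
  rw [rhoMN_apply, sum_apply, inner_sum]
  refine Finset.sum_eq_zero fun j _ => ?_
  rw [sum_apply, inner_sum]
  refine Finset.sum_eq_zero fun p _ => h.inner_term_eq_zero f j p x x fun w h1 h2 => ?_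
  exact hno ⟨m, n, j, p, w, hk, h1.symm, h2.symm⟩

theorem D_eq_bot_of_essentiallyFree (h : Admissible γ S) (hemb : ∀ k, Topology.IsEmbedding (γ k))
    (hUimo : ∀ k, IsOpen (γ k '' U)) (hSU : S ⊆ U) (hfree : EssentiallyFree γ) {k : ℤ}
    (hk : k ≠ 0) : h.D k = ⊥ := by
  rw [eq_bot_iff]
  rintro b ⟨hbB, hbD⟩
  rw [Submodule.mem_bot]
  refine Mat.ext_inner fun x y => ?_
  rw [zero_apply, inner_zero_right]
  by_contra hne
  obtain rfl := hbD x y hne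
  obtain ⟨m, n, j, p, z, hmn, hjz, hpz⟩ := h.exists_of_inner_ne_zero hbB hne
  have hcont := h.continuous_inner_of_mem_B hemb hUimo hSU j p (hmn ▸ hbB)
  have hmn' : m ≠ n := by rintro rfl; exact hk (by rw [← hmn, sub_self])
  have hnd : interior (closure {x : X | comp γ j x = comp γ p x}) = ∅ := hfree ⟨m, j⟩ ⟨n, p⟩ fun he => hmn' (congrArg Sigma.fst he)
  obtain ⟨O, hO, hOeq⟩ := isOpen_induced_iff.1 (isOpen_ne_fun hcont (continuous_const (y := (0 : ℂ))))
  have hzO : (z : X) ∈ O := by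
    have : z ∈ Subtype.val ⁻¹' O := by
      rw [hOeq]
      change ⟪basisVec (h.compS j z), b (basisVec (h.compS p z))⟫_ℂ ≠ 0
      rwa [hjz, hpz]
    exact this
  -- On `O ∩ S` the entry is nonzero, so diagonality forces the two words to agree there; density of
  -- `S` gives the rest.
  have hsub : O ⊆ closure {x : X | comp γ j x = comp γ p x} := by
    refine (h.dense.open_subset_closure_inter hO).trans (closure_mono ?_)
    rintro w ⟨hwO, hwS⟩
    have hw : (⟨w, hwS⟩ : S) ∈ Subtype.val ⁻¹' O := hwO
    rw [hOeq] at hw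
    exact congrArg Subtype.val (hbD _ _ hw)
  have : (z : X) ∈ interior (closure {x : X | comp γ j x = comp γ p x}) :=
    interior_maximal hsub hO hzO
  rw [hnd] at this
  exact this

theorem exists_D_ne_bot_of_not_essentiallyFree (h : Admissible γ S) (hUo : IsOpen U)
    (hUd : Dense U) (hUdisj : Pairwise fun j k => Disjoint (γ j '' U) (γ k '' U))
    (hUimo : ∀ k, IsOpen (γ k '' U)) (hUsub : ∀ k, γ k '' U ⊆ U) (hSU : S ⊆ U)
    (hfree : ¬ EssentiallyFree γ) : ∃ k : ℤ, k ≠ 0 ∧ h.D k ≠ ⊥ := by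
  classical
  simp only [EssentiallyFree, not_forall] at hfree
  obtain ⟨⟨m, j⟩, ⟨n, k⟩, hne, hnd⟩ := hfree
  have hclosed : IsClosed {x : X | comp γ j x = comp γ k x} :=
    isClosed_eq (continuous_comp γ j) (continuous_comp γ k)
  rw [hclosed.isNowhereDense_iff, ← ne_eq, ← Set.nonempty_iff_ne_empty] at hnd
  have hcoin : ∀ x ∈ interior {x : X | comp γ j x = comp γ k x}, comp γ j x = comp γ k x :=
    fun x hx => interior_subset (s := {x : X | comp γ j x = comp γ k x}) hx
  have hVo := (isOpen_interior (s := {x : X | comp γ j x = comp γ k x})).inter hUo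
  have hVne := hUd.inter_open_nonempty _ isOpen_interior hnd
  obtain ⟨x₀, hxV, hxS⟩ := h.dense.inter_open_nonempty _ hVo hVne
  -- Words of equal length that agree at a point of `S` are the same word.
  have hmn : m ≠ n := by
    rintro rfl
    have he : h.compS j ⟨x₀, hxS⟩ = h.compS k ⟨x₀, hxS⟩ := Subtype.ext (hcoin _ hxV.1)
    exact hne (by rw [(h.compS_eq he).1])
  obtain ⟨g, hg0, hg1, -⟩ := exists_continuous_zero_one_of_isClosed hVo.isClosed_compl
    (isClosed_singleton (x := x₀)) (by simpa using hxV)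
  obtain ⟨f, hf1, hf0⟩ := exists_bump hUdisj hUimo hUsub j k
    (⟨fun x => (g x : ℂ), by fun_prop⟩ : C(X, ℂ)) (fun x hx => by
      have : g x = 0 := hg0 fun hxV => hx hxV.2
      simp [this])
  have hval : ∀ w : S, h.rhoMN m n f (basisVec (h.compS k w)) =
      (g w : ℂ) • basisVec (h.compS j w) := by
    intro w
    rw [rhoMN_basisVec, Finset.sum_eq_single j]
    · rw [hf1 _ (hSU w.2)]; rfl
    · intro j' _ hj'
      rw [hf0 _ _ _ (hSU w.2) fun he => hj' he.1, zero_smul]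
    · simp
  have hval0 : ∀ y : S, (∀ w : S, g w ≠ 0 → h.compS k w ≠ y) → h.rhoMN m n f (basisVec y) = 0 := by
    intro y hy
    by_cases hex : ∃ (k' : Fin n → Fin N) (w : S), h.compS k' w = y
    · obtain ⟨k', w, rfl⟩ := hex
      by_cases hk' : k' = k
      · subst hk'
        have : g w = 0 := by
          by_contra hgw
          exact hy w hgw rfl
        rw [hval, this, Complex.ofReal_zero, zero_smul]
      · rw [rhoMN_basisVec]
        refine Finset.sum_eq_zero fun j' _ => ?_
        rw [hf0 _ _ _ (hSU w.2) fun he => hk' he.2, zero_smul]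
    · exact h.rhoMN_basisVec_of_notMem f y fun k' w he => hex ⟨k', w, he⟩
  refine ⟨(m : ℤ) - n, by omega, fun hbot => ?_⟩
  -- The operator sends `e_{γ_k w}` to `g w • e_{γ_j w}`, and `γ_j w = γ_k w` wherever `g w ≠ 0`.
  have hmem : h.rhoMN m n f ∈ h.D ((m : ℤ) - n) := by
    refine ⟨h.rhoMN_mem_B rfl f, fun x y hxy => ?_⟩
    by_cases hex : ∃ w : S, g w ≠ 0 ∧ h.compS k w = y
    · obtain ⟨w, hgw, rfl⟩ := hex
      have hwV : (w : X) ∈ interior {x : X | comp γ j x = comp γ k x} ∩ U := by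
        by_contra hw
        exact hgw (hg0 hw)
      have he : h.compS j w = h.compS k w := Subtype.ext (hcoin _ hwV.1)
      rw [hval, inner_smul_right, inner_basisVec_basisVec, he] at hxy
      by_contra hne
      exact hxy (by rw [if_neg hne, mul_zero])
    · rw [hval0 y fun w hgw he => hex ⟨w, hgw, he⟩, inner_zero_right] at hxy
      exact absurd rfl hxy
  rw [hbot, Submodule.mem_bot] at hmem
  have := hval ⟨x₀, hxS⟩
  rw [hmem, zero_apply, show g x₀ = 1 from hg1 rfl, Complex.ofReal_one, one_smul] at this
  have hn := norm_basisVec (h.compS j ⟨x₀, hxS⟩)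
  rw [← this, norm_zero] at hn
  exact zero_ne_one hn

/-! ### Components of `D̂` -/

/-- `coeff S k` is a continuous left inverse of `tensorShift S k`. Closedness is what lets `D_0 ⊗
υ_0` equal `D̂`, defined as a closure. -/
theorem isClosed_map_tensorShift_D (h : Admissible γ S) (k : ℤ) :
    IsClosed ((h.D k).map (tensorShift S k) : Set (HatMat S)) := by
  have : ((h.D k).map (tensorShift S k) : Set (HatMat S)) =
      coeff S k ⁻¹' (h.D k) ∩ {b | tensorShift S k (coeff S k b) = b} := by
    ext b
    constructor
    · rintro ⟨c, hc, rfl⟩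
      have := coeff_tensorShift k k c
      rw [if_pos rfl] at this
      refine ⟨?_, ?_⟩
      · rw [Set.mem_preimage, this]; exact hc
      · rw [Set.mem_ofPred_eq, this]
    · rintro ⟨h1, h2⟩
      exact ⟨_, h1, h2⟩
  rw [this]
  exact ((h.isClosed_D k).preimage (coeff S k).continuous).inter
    (isClosed_eq ((continuous_tensorShift k).comp (coeff S k).continuous) continuous_id)

theorem DHat_eq_iff (h : Admissible γ S) :
    h.DHat = (h.D 0).map (tensorShift S 0) ↔ ∀ k : ℤ, k ≠ 0 → h.D k = ⊥ := by
  constructor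
  · intro heq k hk
    rw [eq_bot_iff]
    intro b hb
    have hmem := h.tensorShift_mem_DHat hb
    rw [heq] at hmem
    obtain ⟨c, -, hc⟩ := hmem
    have := congrArg (coeff S k) hc
    rw [coeff_tensorShift, coeff_tensorShift, if_neg hk.symm, if_pos rfl] at this
    exact this.symm
  · intro hbot
    refine le_antisymm (h.DHat_le (h.isClosed_map_tensorShift_D 0) fun k b hb => ?_) ?_
    · by_cases hk : k = 0
      · subst hk; exact ⟨b, hb, rfl⟩
      · rw [hbot k hk, Submodule.mem_bot] at hb
        rw [hb, map_zero]
        exact zero_mem _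
    · rintro _ ⟨b, hb, rfl⟩
      exact h.tensorShift_mem_DHat hb

/-- A nonzero element of degree `k ≠ 0` cannot come from `ρ̂_A(A)`, whose coefficient at `k`
vanishes. -/
theorem range_rhoHatA_ssubset (h : Admissible γ S) {k : ℤ} (hk : k ≠ 0) (hD : h.D k ≠ ⊥) :
    Set.range h.rhoHatA ⊂ (h.DHat : Set (HatMat S)) := by
  obtain ⟨b, hb, hb0⟩ := Submodule.exists_mem_ne_zero_of_ne_bot hD
  refine ⟨by rintro _ ⟨a, rfl⟩; exact h.rhoHatA_mem_DHat a, fun hsub => hb0 ?_⟩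
  obtain ⟨a, ha⟩ := hsub (h.tensorShift_mem_DHat hb)
  have := congrArg (coeff S k) ha
  rw [rhoHatA, coeff_tensorShift, coeff_tensorShift, if_neg hk.symm, if_pos rfl] at this
  exact this.symm

theorem not_isMasa_of_ssubset_DHat (h : Admissible γ S) {T : Set (HatMat S)}
    (hT : T ⊂ (h.DHat : Set (HatMat S))) : ¬ IsMasa h.cstarHat T := by
  rintro ⟨F, rfl, hF⟩
  refine hT.2 (hF.2 (y := h.DHatAlg) ⟨fun b hb => ((h.mem_DHat_iff b).1 hb).1, h.isClosed_DHat,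
    fun a ha b hb => h.DHat_mul_comm ha hb⟩ hT.1)

end Admissible

end KW

end

theorem theorem5p5p5 {X : Type*} [TopologicalSpace X] [CompactSpace X] [T2Space X] {N : ℕ}
    (γ : Fin N → C(X, X)) (S U : Set X)
    (hS : KW.Admissible γ S)
    (hemb : ∀ k, Topology.IsEmbedding (γ k))
    (hUo : IsOpen U) (hUd : Dense U)
    (hUdisj : Pairwise fun j k => Disjoint (γ j '' U) (γ k '' U))
    (hUimo : ∀ k, IsOpen (γ k '' U))
    (hUsub : ∀ k, γ k '' U ⊆ U)
    (hSU : S ⊆ U) (hScom : S ∈ residual X) :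
    [KW.EssentiallyFree γ,
      ∀ k : ℤ, k ≠ 0 → hS.D k = ⊥,
      hS.DHat = (hS.D 0).map (KW.tensorShift S 0)].TFAE ∧
    KW.IsMasa hS.cstarHat (hS.DHat : Set (KW.HatMat S)) ∧
    (¬ KW.EssentiallyFree γ →
      Set.range hS.rhoHatA ⊂ (hS.DHat : Set (KW.HatMat S)) ∧
      ¬ KW.IsMasa hS.cstarHat (Set.range hS.rhoHatA)) := by
  have hDne : ¬ KW.EssentiallyFree γ → ∃ k : ℤ, k ≠ 0 ∧ hS.D k ≠ ⊥ :=
    hS.exists_D_ne_bot_of_not_essentiallyFree hUo hUd hUdisj hUimo hUsub hSU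
  refine ⟨?_, hS.isMasa_DHat, fun hfree => ?_⟩
  · tfae_have 1 → 2 := fun hfree k hk =>
      hS.D_eq_bot_of_essentiallyFree hemb hUimo hSU hfree hk
    tfae_have 2 → 1 := fun hbot => by
      by_contra hfree
      obtain ⟨k, hk, hD⟩ := hDne hfree
      exact hD (hbot k hk)
    tfae_have 3 ↔ 2 := hS.DHat_eq_iff
    tfae_finish
  · obtain ⟨k, hk, hD⟩ := hDne hfree
    have hss := hS.range_rhoHatA_ssubset hk hD
    exact ⟨hss, hS.not_isMasa_of_ssubset_DHat hss⟩
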